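/- **Model.** For each $m\in\mathbb N$ (the number of tests) let $\gamma_m=(p_m,\tau_m^2,\sigma_m^2,\delta_{0m},\delta_{Am})$ with $p_m\in(0,1)$ and $\tau_m,\sigma_m,\delta_{0m},\delta_{Am}>0$. The pairs $(\nu_i,X_i)$, $i=1,\dots,m$, are independent and identically distributed, with $P(\nu_i=1)=p_m=1-P(\nu_i=0)$, $X_i\mid\nu_i=0\sim N(0,\sigma_m^2)$ and $X_i\mid\nu_i=1\sim N(0,\sigma_m^2+\tau_m^2)$. The null hypothesis $H_{0i}$ is the event $\nu_i=0$. Put $f_m=\frac{1-p_m}{p_m}$, $\delta_m=\frac{\delta_{0m}}{\delta_{Am}}$, $u_m=\left(\frac{\tau_m}{\sigma_m}\right)^2$ and $v_m=u_mf_m^2\delta_m^2$. A multiple testing rule selects, on the basis of $X_1,\dots,X_m$, the set of rejected null hypotheses. With $t_{1i}=P(H_{0i}\text{ is rejected}\mid\nu_i=0)$ and $t_{2i}=P(H_{0i}\text{ is accepted}\mid\nu_i=1)$, its Bayes risk is $$R=\sum_{i=1}^m\{(1-p_m)\,t_{1i}\,\delta_{0m}+p_m\,t_{2i}\,\delta_{Am}\}.$$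 The Bayes oracle rejects $H_{0i}$ if and only if $X_i^2/\sigma_m^2\ge c^2$, where $$c^2=\frac{\sigma_m^2+\tau_m^2}{\tau_m^2}\Big(\log\Big(\Big(\frac{\tau_m}{\sigma_m}\Big)^2+1\Big)+2\log(f_m\delta_m)\Big);$$ $R_{opt}$ denotes its Bayes risk. A sequence of rules is *asymptotically optimal* if $R/R_{opt}\to1$ as $m\to\infty$. **BFDR.** For $c\ge 0$, the Bayesian false discovery rate of the rule that rejects $H_{0i}$ when $X_i^2/\sigma_m^2\ge c^2$ is $P(H_{0i}\text{ is true}\mid X_i^2/\sigma_m^2\ge c^2)$, which does not depend on $i$. The rule controlling the BFDR at level $\alpha$ is the rule of this form whose BFDR equals $\alpha$. **Benjamini–Hochberg procedure (BH) at level $\alpha$.** Let $p_i=2(1-\Phi(|X_i|/\sigma_m))$, where $\Phi$ is the standard normal distribution function, and let $p_{(1)}\le\dots\le p_{(m)}$ be the sorted values. If $k$ is the largest index $j$ with $p_{(j)}\le j\alpha/m$, BH rejects every $H_{0i}$ with $p_i\le p_{(k)}$; it rejects nothing if there is no such index. **Theorem.** Suppose that, as $m\to\infty$, $u_m\to\infty$,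 $v_m\to\infty$ and $\frac{\log v_m}{u_m}\to C$ for some $C\in[0,\infty)$. Suppose that $p_m\to0$ and $mp_m\to s$ for some $s\in(0,\infty]$. Let $\alpha_m\to\alpha_\infty<1$ be such that, for all sufficiently large $m$, a rule controlling the BFDR at level $\alpha_m$ exists, and such that these rules are asymptotically optimal. If moreover $\frac{\log(mp_m)}{\log m}\to C_p$ for some $C_p\in(0,1]$, assume in addition that for some $\beta>0$, $u_m\le m^\beta$ for all sufficiently large $m$. Then BH at level $\alpha_m$ is asymptotically optimal: its Bayes risk divided by $R_{opt}$ tends to $1$ as $m\to\infty$. -/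

import Mathlib

open Filter Topology MeasureTheory ProbabilityTheory

noncomputable section

namespace SparseTesting

/-- The parameters `γ = (p, τ², σ², δ₀, δ_A)` of a two-groups testing problem with additive loss:
the probability `p` that a null hypothesis is false, the standard deviation `σ` of an observation
under the null hypothesis (variance `σ²`), the extra variance `τ²` under the alternative, the loss
`δ0` of a type I error and the loss `δA` of a type II error. -/
structure Params where
  p : ℝ
  τ : ℝ
  σ : ℝ
  δ0 : ℝ
  δA : ℝ
  p_pos : 0 < p
  p_lt_one : p < 1
  τ_pos : 0 < τ
  σ_pos : 0 < σ
  δ0_pos : 0 < δ0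
  δA_pos : 0 < δA

namespace Params

variable (γ : Params)

/-- The odds `f = (1 - p) / p` of a null hypothesis. -/
def f : ℝ := (1 - γ.p) / γ.p

/-- The ratio of losses `δ = δ₀ / δ_A`. -/
def δ : ℝ := γ.δ0 / γ.δA

/-- The signal magnitude `u = (τ / σ)²`. -/
def u : ℝ := (γ.τ / γ.σ) ^ 2

/-- The parameter `v = u f² δ²`. -/
def v : ℝ := γ.u * γ.f ^ 2 * γ.δ ^ 2

/-- The joint law of one pair `(ν, X)`: `ν` is Bernoulli with parameter `p` (`ν = true` means that
the alternative holds), and `X` is `N(0, σ²)` given `ν = false` and `N(0, σ² + τ²)` given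
`ν = true`. -/
def pairLaw : Measure (Bool × ℝ) :=
  ENNReal.ofReal (1 - γ.p) •
      (Measure.dirac false).prod (gaussianReal 0 (Real.toNNReal (γ.σ ^ 2))) +
    ENNReal.ofReal γ.p •
      (Measure.dirac true).prod (gaussianReal 0 (Real.toNNReal (γ.σ ^ 2 + γ.τ ^ 2)))

instance : IsProbabilityMeasure γ.pairLaw := by
  constructor
  simp only [pairLaw, Measure.coe_add, Measure.coe_smul, Pi.add_apply, Pi.smul_apply, measure_univ,
    smul_eq_mul, mul_one]
  rw [← ENNReal.ofReal_add (by linarith [γ.p_lt_one]) γ.p_pos.le]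
  simp

/-- The joint law of the `m` independent pairs `(ν₁, X₁), …, (ν_m, X_m)`. -/
def dataLaw (m : ℕ) : Measure (Fin m → Bool × ℝ) := Measure.pi fun _ => γ.pairLaw

instance (m : ℕ) : IsProbabilityMeasure (γ.dataLaw m) := by
  unfold dataLaw; infer_instance

end Params

/-- A multiple testing rule for `m` tests: the set of rejected null hypotheses, as a function of
the observations `X₁, …, X_m`. -/
abbrev TestRule (m : ℕ) : Type := (Fin m → ℝ) → Set (Fin m)

/-- `t_{1i}`, the probability of rejecting the `i`-th null hypothesis given that it is true. -/
def typeOneProb (γ : Params) {m : ℕ} (T : TestRule m) (i : Fin m) : ℝ :=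
  (cond (γ.dataLaw m) {ω | (ω i).1 = false}).real {ω | i ∈ T fun j => (ω j).2}

/-- `t_{2i}`, the probability of accepting the `i`-th null hypothesis given that it is false. -/
def typeTwoProb (γ : Params) {m : ℕ} (T : TestRule m) (i : Fin m) : ℝ :=
  (cond (γ.dataLaw m) {ω | (ω i).1 = true}).real {ω | i ∉ T fun j => (ω j).2}

/-- The Bayes risk of a multiple testing rule under the additive loss. -/
def risk (γ : Params) {m : ℕ} (T : TestRule m) : ℝ :=
  ∑ i : Fin m, ((1 - γ.p) * typeOneProb γ T i * γ.δ0 + γ.p * typeTwoProb γ T i * γ.δA)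

/-- The fixed threshold rule: reject the `i`-th null hypothesis if `X_i² / σ² ≥ K`. -/
def thresholdRule (γ : Params) (m : ℕ) (K : ℝ) : TestRule m :=
  fun x => {i | K ≤ x i ^ 2 / γ.σ ^ 2}

/-- The threshold `c²` of the Bayes oracle. -/
def oracleThreshold (γ : Params) : ℝ :=
  (γ.σ ^ 2 + γ.τ ^ 2) / γ.τ ^ 2 *
    (Real.log ((γ.τ / γ.σ) ^ 2 + 1) + 2 * Real.log (γ.f * γ.δ))

/-- The optimal risk: the Bayes risk of the Bayes oracle. -/
def optRisk (γ : Params) (m : ℕ) : ℝ := risk γ (thresholdRule γ m (oracleThreshold γ))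

/-- The conditions on the sequence of parameters (indexed by the number of tests):
`u → ∞`, `v → ∞` and `log v / u → C` for some `C ∈ [0, ∞)`. -/
def AssumptionA (γ : ℕ → Params) : Prop :=
  Tendsto (fun m => (γ m).u) atTop atTop ∧
  Tendsto (fun m => (γ m).v) atTop atTop ∧
  ∃ C : ℝ, 0 ≤ C ∧ Tendsto (fun m => Real.log (γ m).v / (γ m).u) atTop (𝓝 C)

/-- A sequence of multiple testing rules is asymptotically optimal if the ratio of its Bayes risk
to the optimal risk tends to one. -/
def AsymptoticallyOptimal (γ : ℕ → Params) (T : ∀ m : ℕ, TestRule m) : Prop :=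
  Tendsto (fun m => risk (γ m) (T m) / optRisk (γ m) m) atTop (𝓝 1)

/-- The Bayesian false discovery rate of the fixed threshold rule with threshold `K`: the
probability that a null hypothesis is true given that it is rejected. -/
def bfdr (γ : Params) (K : ℝ) : ℝ :=
  (cond γ.pairLaw {y | K ≤ y.2 ^ 2 / γ.σ ^ 2}).real {y | y.1 = false}

/-- The two-sided p-value `2 (1 - Φ(|x| / σ))` of an observation `x`. -/
def pValue (γ : Params) (x : ℝ) : ℝ := 2 * (1 - cdf (gaussianReal 0 1) (|x| / γ.σ))

/-- The order statistics of `q`: `q_(1) ≤ … ≤ q_(m)`, where `orderStat q k` is `q_(k+1)`, since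
`Fin m` counts from zero. -/
def orderStat {m : ℕ} (q : Fin m → ℝ) (k : Fin m) : ℝ := q (Tuple.sort q k)

/-- The Benjamini–Hochberg procedure at level `α`: if `k` is the largest index with
`p_(k) ≤ k α / m`, reject all null hypotheses whose p-value is at most `p_(k)`; reject none if
there is no such `k`. -/
def bhRule (γ : Params) (m : ℕ) (α : ℝ) : TestRule m :=
  fun x => {i | ∃ k : Fin m,
    IsGreatest {k : Fin m |
      orderStat (fun j => pValue γ (x j)) k ≤ ((k : ℕ) + 1 : ℝ) * α / m} k ∧
    pValue γ (x i) ≤ orderStat (fun j => pValue γ (x j)) k}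

end SparseTesting

end

/-! Write `G(c)` for the null tail `P(|Z| ≥ c)`, `T(c)` for the type II error of the rule with
threshold `c ^ 2`, and `c` for the threshold controlling the BFDR at level `α`. Per false null and
in units of `δA`, the risk of that rule is `f δ G(c) + T(c)`, and its BFDR equation reads `(1 - α)
(1 - p) G(c) = α p (1 - T(c))`.

The oracle minimizes the risk over all measurable rules, so only an upper bound for the risk of BH
is needed. Comparison with the threshold `ℓ = √(log v)` shows that asymptotic optimality forces `c →
∞`, keeps `1 - T(c)` away from `0`, and makes `f δ G(c)` negligible against the total. A constant
factor may therefore be lost in the type I component, whereas the type II component must be sharp up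
to `1 + o(1)`.

Type I (`bhRule_typeOne_le`): a rejected `p_i` is at most `R_i α / m`, where `R_i` is the number of
rejections after `p_i` is replaced by `0`. As `R_i` is independent of `p_i`, a null is rejected with
probability at most `E[R_i] α / m`. A recursion on the set of zeroed p-values (`meanStepUp_le`)
gives `E[R_i] = O(1 + m p) = O(m p)`, and the BFDR equation turns `α p` into `O(G(c))`.

Type II (`bhRule_typeTwo_le`): with probability exponentially close to `1` in `m p`, a fixed
fraction of `m p` p-values is small, and then BH rejects beyond some `d = c + O(1 / c)`. Otherwise
the Bonferroni threshold `e = c + O(log(1 + m p) / c)` still rejects. Since `T` grows at most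
linearly under dilations, both contributions fit into `(1 + O(c⁻²)) T(c)`: the logarithm in `e` is
absorbed by the exponentially small probability, whatever the size of `m p`. -/

noncomputable section

namespace SparseTesting

/-! ### Tails of the standard normal law -/

/-- The two-sided tail probability `P(|Z| ≥ c)` of a standard normal variable. -/
def normalTail (c : ℝ) : ℝ := (gaussianReal 0 1).real {z | c ≤ |z|}

theorem normalTail_nonneg (c : ℝ) : 0 ≤ normalTail c := measureReal_nonneg

theorem normalTail_le_one (c : ℝ) : normalTail c ≤ 1 := measureReal_le_one

theorem normalTail_antitone : Antitone normalTail := fun _ _ h =>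
  measureReal_mono fun _ hz => h.trans hz

theorem gaussianReal_real_eq_setIntegral (s : Set ℝ) :
    (gaussianReal 0 1).real s = ∫ x in s, gaussianPDFReal 0 1 x := by
  rw [measureReal_def, gaussianReal_apply_eq_integral _ one_ne_zero, ENNReal.toReal_ofReal]
  exact integral_nonneg fun x => gaussianPDFReal_nonneg _ _ _

theorem gaussianPDFReal_zero_one (x : ℝ) :
    gaussianPDFReal 0 1 x = (√(2 * Real.pi))⁻¹ * Real.exp (-x ^ 2 / 2) := by
  simp [gaussianPDFReal]

theorem continuous_gaussianPDFReal_zero_one : Continuous (gaussianPDFReal 0 1) := by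
  rw [show gaussianPDFReal 0 1 = _ from funext gaussianPDFReal_zero_one]
  fun_prop

theorem normalTail_eq_one_sub {c : ℝ} (hc : 0 ≤ c) :
    normalTail c = 1 - ∫ x in (-c)..c, gaussianPDFReal 0 1 x := by
  have h : {z : ℝ | c ≤ |z|} = (Set.Ioo (-c) c)ᶜ := by
    ext z
    simp [← abs_lt]
  rw [normalTail, h, measureReal_compl measurableSet_Ioo, probReal_univ,
    gaussianReal_real_eq_setIntegral, intervalIntegral.integral_of_le (by linarith),
    integral_Ioc_eq_integral_Ioo]

theorem normalTail_eq_two_mul {c : ℝ} (hc : 0 ≤ c) :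
    normalTail c = 2 * (gaussianReal 0 1).real (Set.Ici c) := by
  rcases hc.eq_or_lt with rfl | hc
  · have h1 : (gaussianReal 0 1).real (Set.Iic 0) = (gaussianReal 0 1).real (Set.Ici 0) := by
      have := gaussianReal_map_neg (μ := 0) (v := 1)
      rw [neg_zero] at this
      conv_lhs => rw [← this]
      rw [map_measureReal_apply measurable_neg measurableSet_Iic]
      congr 1
      ext z; simp
    have h2 : (gaussianReal 0 1).real (Set.Iic 0) + (gaussianReal 0 1).real (Set.Ioi 0) = 1 := by
      rw [← measureReal_union (Set.Iic_disjoint_Ioi le_rfl) measurableSet_Ioi,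
        Set.Iic_union_Ioi, probReal_univ]
    have h3 : (gaussianReal 0 1).real (Set.Ioi (0 : ℝ)) = (gaussianReal 0 1).real (Set.Ici 0) := by
      have := nullSingletonClass_gaussianReal (μ := 0) (v := 1) one_ne_zero
      exact measureReal_congr Ioi_ae_eq_Ici
    have h4 : normalTail 0 = 1 := by
      simp [normalTail]
    rw [h4]; linarith
  · have h : {z : ℝ | c ≤ |z|} = Set.Iic (-c) ∪ Set.Ici c := by
      ext z
      simp only [Set.mem_ofPred_eq, le_abs, Set.mem_union, Set.mem_Iic, Set.mem_Ici]
      constructor <;> rintro (h | h) <;> [right; left; right; left] <;> linarith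
    have h1 : (gaussianReal 0 1).real (Set.Iic (-c)) = (gaussianReal 0 1).real (Set.Ici c) := by
      have := gaussianReal_map_neg (μ := 0) (v := 1)
      rw [neg_zero] at this
      conv_lhs => rw [← this]
      rw [map_measureReal_apply measurable_neg measurableSet_Iic]
      congr 1
      ext z; simp
    rw [normalTail, h, measureReal_union _ measurableSet_Ici, h1, two_mul]
    exact Set.disjoint_left.2 fun z hz hz' => by
      simp only [Set.mem_Iic, Set.mem_Ici] at hz hz'
      linarith

@[simp]
theorem normalTail_zero : normalTail 0 = 1 := by
  simp [normalTail]

theorem two_mul_one_sub_cdf {c : ℝ} (hc : 0 ≤ c) :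
    2 * (1 - cdf (gaussianReal 0 1) c) = normalTail c := by
  have := nullSingletonClass_gaussianReal (μ := 0) (v := 1) one_ne_zero
  rw [normalTail_eq_two_mul hc, cdf_eq_real, ← probReal_univ (μ := gaussianReal 0 1),
    ← measureReal_compl measurableSet_Iic, Set.compl_Iic, measureReal_congr Ioi_ae_eq_Ici]

/-- Gaussian decay of the tail. -/
theorem normalTail_add_le {c y : ℝ} (hc : 0 ≤ c) (hy : 0 ≤ y) :
    normalTail (c + y) ≤ Real.exp (-(c * y) - y ^ 2 / 2) * normalTail c := by
  rw [normalTail_eq_two_mul hc, normalTail_eq_two_mul (add_nonneg hc hy),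
    gaussianReal_real_eq_setIntegral, gaussianReal_real_eq_setIntegral, integral_Ici_eq_integral_Ioi,
    integral_Ici_eq_integral_Ioi, ← (measurePreserving_add_left volume y).setIntegral_preimage_emb
      (MeasurableEquiv.addLeft y).measurableEmbedding, Set.preimage_const_add_Ioi,
    add_sub_cancel_right, mul_left_comm (Real.exp _) 2]
  gcongr 2 * ?_
  rw [← integral_const_mul]
  have hint := (integrable_gaussianPDFReal 0 1)
  refine setIntegral_mono_on (hint.comp_add_left y).integrableOn
    (hint.const_mul _).integrableOn measurableSet_Ioi fun x hx => ?_
  rw [gaussianPDFReal_zero_one, gaussianPDFReal_zero_one, mul_left_comm, ← Real.exp_add]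
  gcongr
  have := mul_le_mul_of_nonneg_right (le_of_lt (Set.mem_Ioi.1 hx)) hy
  nlinarith

theorem normalTail_add_le_exp_mul {c y : ℝ} (hc : 0 ≤ c) (hy : 0 ≤ y) :
    normalTail (c + y) ≤ Real.exp (-(c * y)) * normalTail c := by
  refine (normalTail_add_le hc hy).trans ?_
  gcongr
  · exact normalTail_nonneg c
  · nlinarith

theorem normalTail_le_exp {c : ℝ} (hc : 0 ≤ c) : normalTail c ≤ Real.exp (-c ^ 2 / 2) := by
  have := normalTail_add_le le_rfl hc
  rw [normalTail_zero] at this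
  convert this using 1
  · simp
  · simp; ring_nf

theorem gaussianPDFReal_zero_one_anti {x y : ℝ} (h : |x| ≤ |y|) :
    gaussianPDFReal 0 1 y ≤ gaussianPDFReal 0 1 x := by
  rw [gaussianPDFReal_zero_one, gaussianPDFReal_zero_one]
  have := sq_le_sq.2 h
  gcongr

theorem one_sub_normalTail_nonneg (c : ℝ) : 0 ≤ 1 - normalTail c := by
  linarith [normalTail_le_one c]

/-- The mass of `(-c, c)` is at most linear under dilations. -/
theorem one_sub_normalTail_mul_le {r c : ℝ} (hr : 1 ≤ r) (hc : 0 ≤ c) :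
    1 - normalTail (r * c) ≤ r * (1 - normalTail c) := by
  have hr0 : 0 < r := by linarith
  rw [normalTail_eq_one_sub hc, normalTail_eq_one_sub (by positivity)]
  have h := intervalIntegral.mul_integral_comp_mul_left (a := -c) (b := c)
    (f := gaussianPDFReal 0 1) r
  rw [mul_neg] at h
  rw [sub_sub_cancel, sub_sub_cancel, ← h]
  gcongr
  refine intervalIntegral.integral_mono_on (by linarith) ?_ ?_ fun x _ => ?_
  · exact (continuous_gaussianPDFReal_zero_one.comp (continuous_const_mul r)).intervalIntegrable _ _
  · exact continuous_gaussianPDFReal_zero_one.intervalIntegrable _ _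
  · apply gaussianPDFReal_zero_one_anti
    rw [abs_mul, abs_of_pos hr0]
    exact le_mul_of_one_le_left (abs_nonneg x) hr

theorem gaussianPDFReal_zero_one_le : gaussianPDFReal 0 1 0 ≤ 1 / 2 := by
  rw [gaussianPDFReal_zero_one]
  have h : 2 ≤ √(2 * Real.pi) := by
    apply Real.le_sqrt_of_sq_le
    nlinarith [Real.pi_gt_three]
  have := inv_anti₀ (by norm_num) h
  simpa using this

theorem one_sub_normalTail_le {x : ℝ} (hx : 0 ≤ x) : 1 - normalTail x ≤ x := by
  rw [normalTail_eq_one_sub hx, sub_sub_cancel]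
  calc ∫ t in (-x)..x, gaussianPDFReal 0 1 t ≤ ∫ _ in (-x)..x, (1 / 2 : ℝ) := by
        refine intervalIntegral.integral_mono_on (by linarith)
          (continuous_gaussianPDFReal_zero_one.intervalIntegrable _ _)
          (continuous_const.intervalIntegrable _ _) fun t _ => ?_
        exact (gaussianPDFReal_zero_one_anti (by simp)).trans gaussianPDFReal_zero_one_le
    _ = x := by simp; ring

/-- The density on `[-x, x]` is at least its value at `M`. For bounded arguments this makes the mass
of `(-x, x)` comparable to `x`, which is how type II errors are bounded from below. -/
theorem le_one_sub_normalTail {x M : ℝ} (hx : 0 ≤ x) (hM : x ≤ M) :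
    2 * gaussianPDFReal 0 1 M * x ≤ 1 - normalTail x := by
  rw [normalTail_eq_one_sub hx, sub_sub_cancel]
  calc 2 * gaussianPDFReal 0 1 M * x = ∫ _ in (-x)..x, gaussianPDFReal 0 1 M := by
        simp; ring
    _ ≤ _ := by
        refine intervalIntegral.integral_mono_on (by linarith)
          (continuous_const.intervalIntegrable _ _)
          (continuous_gaussianPDFReal_zero_one.intervalIntegrable _ _) fun t ht => ?_
        apply gaussianPDFReal_zero_one_anti
        rw [abs_of_nonneg (hx.trans hM)]
        exact (abs_le.2 ht).trans hM

/-- Keeping only the interval `[c, c + 1]` of the tail is crude, but the loss is swallowed by the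
quadratic gap in `eventually_le_gaussianPDFReal_mul_exp`. -/
theorem le_normalTail {c : ℝ} (hc : 0 ≤ c) : 2 * gaussianPDFReal 0 1 (c + 1) ≤ normalTail c := by
  rw [normalTail_eq_two_mul hc]
  gcongr
  calc gaussianPDFReal 0 1 (c + 1) = ∫ _ in c..(c + 1), gaussianPDFReal 0 1 (c + 1) := by simp
    _ ≤ ∫ t in c..(c + 1), gaussianPDFReal 0 1 t := by
        refine intervalIntegral.integral_mono_on (by linarith)
          (continuous_const.intervalIntegrable _ _)
          (continuous_gaussianPDFReal_zero_one.intervalIntegrable _ _) fun t ht => ?_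
        apply gaussianPDFReal_zero_one_anti
        rw [abs_of_nonneg (hc.trans ht.1), abs_of_nonneg (by linarith)]
        exact ht.2
    _ = (gaussianReal 0 1).real (Set.Ioc c (c + 1)) := by
        rw [intervalIntegral.integral_of_le (by linarith), gaussianReal_real_eq_setIntegral]
    _ ≤ _ := measureReal_mono fun t ht => ht.1.le

theorem gaussianPDFReal_zero_one_pos (x : ℝ) : 0 < gaussianPDFReal 0 1 x :=
  gaussianPDFReal_pos _ _ _ one_ne_zero

theorem normalTail_pos (c : ℝ) : 0 < normalTail c := by
  refine lt_of_lt_of_le ?_ (normalTail_antitone (le_abs_self c))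
  exact lt_of_lt_of_le (by have := gaussianPDFReal_zero_one_pos (|c| + 1); positivity)
    (le_normalTail (abs_nonneg c))

theorem continuousOn_normalTail : ContinuousOn normalTail (Set.Ici 0) := by
  have h : ContinuousOn (fun c : ℝ => 1 - ∫ x in (-c)..c, gaussianPDFReal 0 1 x) (Set.Ici 0) := by
    have hp : Continuous fun c : ℝ => ∫ x in (0 : ℝ)..c, gaussianPDFReal 0 1 x :=
      intervalIntegral.continuous_primitive
        (fun a b => continuous_gaussianPDFReal_zero_one.intervalIntegrable a b) 0
    have : (fun c : ℝ => 1 - ∫ x in (-c)..c, gaussianPDFReal 0 1 x) = fun c =>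
        1 - ((∫ x in (0 : ℝ)..c, gaussianPDFReal 0 1 x) -
          ∫ x in (0 : ℝ)..(-c), gaussianPDFReal 0 1 x) := by
      ext c
      rw [intervalIntegral.integral_interval_sub_left] <;>
        exact continuous_gaussianPDFReal_zero_one.intervalIntegrable _ _
    rw [this]
    exact (continuous_const.sub (hp.sub (hp.comp continuous_neg))).continuousOn
  exact h.congr fun c hc => normalTail_eq_one_sub hc

/-- The tail transform of a standard normal variable is stochastically at least uniform. -/
theorem gaussianReal_normalTail_le {t : ℝ} (ht : 0 ≤ t) :
    (gaussianReal 0 1).real {z | normalTail |z| ≤ t} ≤ t := by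
  set A : Set ℝ := {c | 0 ≤ c ∧ normalTail c ≤ t} with hA
  rcases A.eq_empty_or_nonempty with h | h
  · have : {z : ℝ | normalTail |z| ≤ t} = ∅ := by
      ext z
      simp only [Set.mem_ofPred_eq, Set.mem_empty_iff_false, iff_false]
      intro hz
      exact Set.notMem_empty |z| (h ▸ (⟨abs_nonneg z, hz⟩ : |z| ∈ A))
    simpa [this] using ht
  · have hcl : IsClosed A := by
      have := continuousOn_normalTail.preimage_isClosed_of_isClosed isClosed_Ici (isClosed_Iic (a := t))
      exact this
    have hbdd : BddBelow A := ⟨0, fun c hc => hc.1⟩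
    -- Continuity of the tail makes the infimum attained, so the event is contained in a single tail
    -- event whose probability is at most `t`.
    have hmem : sInf A ∈ A := hcl.csInf_mem h hbdd
    refine le_trans (measureReal_mono fun z hz => ?_) hmem.2
    exact csInf_le hbdd ⟨abs_nonneg z, hz⟩

/-! ### Resampling a coordinate of a product measure -/

/-- Resampling one coordinate of an independent identically distributed family preserves its
law. -/
theorem measurePreserving_update {ι E : Type*} [Fintype ι] [DecidableEq ι] [MeasurableSpace E]
    (μ : Measure E) [IsProbabilityMeasure μ] (i : ι) :
    MeasurePreserving (fun z : (ι → E) × E => Function.update z.1 i z.2)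
      ((Measure.pi fun _ => μ).prod μ) (Measure.pi fun _ => μ) := by
  have hm : Measurable fun z : (ι → E) × E => Function.update z.1 i z.2 := by
    refine measurable_pi_iff.2 fun j => ?_
    by_cases h : j = i
    · subst h; simpa using measurable_snd
    · simpa [Function.update_of_ne h, Function.comp_def] using
        (measurable_pi_apply j).comp measurable_fst
  refine ⟨hm, (Measure.pi_eq fun s hs => ?_).symm⟩
  rw [Measure.map_apply hm (MeasurableSet.univ_pi hs)]
  have : (fun z : (ι → E) × E => Function.update z.1 i z.2) ⁻¹' Set.univ.pi s =
      (Set.univ.pi (Function.update s i Set.univ)) ×ˢ s i := by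
    ext z
    simp only [Set.mem_preimage, Set.mem_pi, Set.mem_univ, true_imp_iff, Set.mem_prod]
    constructor
    · intro h
      refine ⟨fun j => ?_, by simpa using h i⟩
      by_cases hj : j = i
      · subst hj; simp
      · simpa [Function.update_of_ne hj] using h j
    · rintro ⟨h1, h2⟩ j
      by_cases hj : j = i
      · subst hj; simpa using h2
      · simpa [Function.update_of_ne hj] using h1 j
  rw [this, Measure.prod_prod, Measure.pi_pi,
    ← Finset.prod_erase_mul _ _ (Finset.mem_univ i), ← Finset.prod_erase_mul _ (fun j => μ (s j))
      (Finset.mem_univ i)]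
  simp only [Function.update_self, measure_univ, mul_one]
  congr 1
  refine Finset.prod_congr rfl fun j hj => ?_
  rw [Function.update_of_ne (Finset.ne_of_mem_erase hj)]

/-- Conditioning on all coordinates except `i`: the probability is an average of one-dimensional
probabilities in the resampled coordinate. It replaces every later appeal to independence. -/
theorem pi_real_eq_integral_update {ι E : Type*} [Fintype ι] [DecidableEq ι] [MeasurableSpace E]
    (μ : Measure E) [IsProbabilityMeasure μ] (i : ι) {S : Set (ι → E)} (hS : MeasurableSet S) :
    (Measure.pi fun _ => μ).real S =
      ∫ ω, μ.real {y | Function.update ω i y ∈ S} ∂(Measure.pi fun _ => μ) := by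
  have h := measurePreserving_update μ i
  rw [← h.measureReal_preimage hS.nullMeasurableSet, measureReal_def,
    Measure.prod_apply (h.measurable hS), ← integral_toReal]
  · rfl
  · exact (measurable_measure_prodMk_left (h.measurable hS)).aemeasurable
  · exact ae_of_all _ fun ω => measure_lt_top _ _

theorem integrable_real_update {ι E : Type*} [Fintype ι] [DecidableEq ι] [MeasurableSpace E]
    (μ : Measure E) [IsProbabilityMeasure μ] (i : ι) {S : Set (ι → E)} (hS : MeasurableSet S) :
    Integrable (fun ω => μ.real {y | Function.update ω i y ∈ S}) (Measure.pi fun _ => μ) := by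
  refine Integrable.of_bound (C := 1) ?_ (ae_of_all _ fun ω => ?_)
  · exact (measurable_measure_prodMk_left
      ((measurePreserving_update μ i).measurable hS)).ennreal_toReal.aestronglyMeasurable
  · rw [Real.norm_of_nonneg measureReal_nonneg]
    exact measureReal_le_one

/-! ### The two-groups law and the Bayes risk -/

namespace Params

variable (γ : Params)

/-- The law of an observation under the null hypothesis. -/
def nullLaw : Measure ℝ := gaussianReal 0 (Real.toNNReal (γ.σ ^ 2))

/-- The law of an observation under the alternative. -/
def altLaw : Measure ℝ := gaussianReal 0 (Real.toNNReal (γ.σ ^ 2 + γ.τ ^ 2))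

instance : IsProbabilityMeasure γ.nullLaw := by unfold nullLaw; infer_instance

instance : IsProbabilityMeasure γ.altLaw := by unfold altLaw; infer_instance

theorem pairLaw_real {S : Set (Bool × ℝ)} (hS : MeasurableSet S) :
    γ.pairLaw.real S = (1 - γ.p) * γ.nullLaw.real {x | (false, x) ∈ S} +
      γ.p * γ.altLaw.real {x | (true, x) ∈ S} := by
  have hp := γ.p_pos
  have hp1 := γ.p_lt_one
  have hd : ∀ (b : Bool) (ν : Measure ℝ) [IsProbabilityMeasure ν],
      ((Measure.dirac b).prod ν) S = ν {x | (b, x) ∈ S} := fun b ν _ => by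
    rw [Measure.dirac_prod, Measure.map_apply measurable_prodMk_left hS]
    rfl
  rw [measureReal_def, pairLaw, Measure.add_apply, Measure.smul_apply, Measure.smul_apply,
    hd, hd, smul_eq_mul, smul_eq_mul,
    ENNReal.toReal_add (by finiteness) (by finiteness)]
  simp only [ENNReal.toReal_mul]
  rw [ENNReal.toReal_ofReal (by linarith), ENNReal.toReal_ofReal hp.le]
  rfl

theorem pairLaw_real_false {A : Set ℝ} (hA : MeasurableSet A) :
    γ.pairLaw.real {y | y.1 = false ∧ y.2 ∈ A} = (1 - γ.p) * γ.nullLaw.real A := by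
  rw [pairLaw_real]
  · simp
  · exact (measurable_fst (measurableSet_singleton false)).inter (measurable_snd hA)

theorem pairLaw_real_true {A : Set ℝ} (hA : MeasurableSet A) :
    γ.pairLaw.real {y | y.1 = true ∧ y.2 ∈ A} = γ.p * γ.altLaw.real A := by
  rw [pairLaw_real]
  · simp
  · exact (measurable_fst (measurableSet_singleton true)).inter (measurable_snd hA)

theorem pairLaw_real_snd {A : Set ℝ} (hA : MeasurableSet A) :
    γ.pairLaw.real {y | y.2 ∈ A} = (1 - γ.p) * γ.nullLaw.real A + γ.p * γ.altLaw.real A := by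
  rw [pairLaw_real]
  · simp
  · exact measurable_snd hA

theorem u_pos : 0 < γ.u := by
  have := γ.τ_pos; have := γ.σ_pos; unfold u; positivity

theorem f_pos : 0 < γ.f := div_pos (by linarith [γ.p_lt_one]) γ.p_pos

theorem δ_pos : 0 < γ.δ := div_pos γ.δ0_pos γ.δA_pos

theorem v_pos : 0 < γ.v := by
  have := γ.u_pos; have := γ.f_pos; have := γ.δ_pos; unfold v; positivity

theorem dataLaw_real_coord {m : ℕ} (i : Fin m) {A : Set (Bool × ℝ)} (hA : MeasurableSet A) :
    (γ.dataLaw m).real {ω | ω i ∈ A} = γ.pairLaw.real A :=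
  (measurePreserving_eval (fun _ : Fin m => γ.pairLaw) i).measureReal_preimage hA.nullMeasurableSet

end Params

theorem cond_real_apply {Ω : Type*} [MeasurableSpace Ω] (μ : Measure Ω) {s : Set Ω}
    (hs : MeasurableSet s) (t : Set Ω) :
    (cond μ s).real t = (μ.real s)⁻¹ * μ.real (s ∩ t) := by
  simp only [measureReal_def]
  rw [cond_apply hs, ENNReal.toReal_mul, ENNReal.toReal_inv]

theorem mul_typeOneProb (γ : Params) {m : ℕ} (T : TestRule m) (i : Fin m) :
    (1 - γ.p) * typeOneProb γ T i =
      (γ.dataLaw m).real {ω | (ω i).1 = false ∧ i ∈ T fun j => (ω j).2} := by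
  have hms : MeasurableSet {y : Bool × ℝ | y.1 = false} :=
    measurable_fst (measurableSet_singleton false)
  have h0 : (γ.dataLaw m).real {ω | (ω i).1 = false} = 1 - γ.p := by
    have := γ.dataLaw_real_coord i hms
    have h2 := γ.pairLaw_real_false MeasurableSet.univ
    simp only [Set.mem_univ, and_true, probReal_univ, mul_one] at h2
    exact this.trans h2
  have hms' : MeasurableSet {ω : Fin m → Bool × ℝ | (ω i).1 = false} :=
    (measurable_pi_apply (X := fun _ : Fin m => Bool × ℝ) i) hms
  rw [typeOneProb, cond_real_apply _ hms', h0, ← mul_assoc,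
    mul_inv_cancel₀ (by linarith [γ.p_lt_one]), one_mul]
  rfl

theorem mul_typeTwoProb (γ : Params) {m : ℕ} (T : TestRule m) (i : Fin m) :
    γ.p * typeTwoProb γ T i =
      (γ.dataLaw m).real {ω | (ω i).1 = true ∧ i ∉ T fun j => (ω j).2} := by
  have hms : MeasurableSet {y : Bool × ℝ | y.1 = true} :=
    measurable_fst (measurableSet_singleton true)
  have h0 : (γ.dataLaw m).real {ω | (ω i).1 = true} = γ.p := by
    have := γ.dataLaw_real_coord i hms
    have h2 := γ.pairLaw_real_true MeasurableSet.univ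
    simp only [Set.mem_univ, and_true, probReal_univ, mul_one] at h2
    exact this.trans h2
  have hms' : MeasurableSet {ω : Fin m → Bool × ℝ | (ω i).1 = true} :=
    (measurable_pi_apply (X := fun _ : Fin m => Bool × ℝ) i) hms
  rw [typeTwoProb, cond_real_apply _ hms', h0, ← mul_assoc,
    mul_inv_cancel₀ γ.p_pos.ne', one_mul]
  rfl

theorem risk_eq (γ : Params) {m : ℕ} (T : TestRule m) :
    risk γ T = ∑ i : Fin m,
      (γ.δ0 * (γ.dataLaw m).real {ω | (ω i).1 = false ∧ i ∈ T fun j => (ω j).2} +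
        γ.δA * (γ.dataLaw m).real {ω | (ω i).1 = true ∧ i ∉ T fun j => (ω j).2}) := by
  unfold risk
  refine Finset.sum_congr rfl fun i _ => ?_
  rw [mul_typeOneProb, mul_typeTwoProb]
  ring

theorem risk_nonneg (γ : Params) {m : ℕ} (T : TestRule m) : 0 ≤ risk γ T := by
  have := γ.δ0_pos; have := γ.δA_pos
  rw [risk_eq]
  positivity

/-! ### Optimality of the Bayes oracle -/

/-- The set of observations for which a single hypothesis is rejected at threshold `K`. -/
def rejectSet (γ : Params) (K : ℝ) : Set ℝ := {x | K ≤ x ^ 2 / γ.σ ^ 2}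

theorem measurableSet_rejectSet (γ : Params) (K : ℝ) : MeasurableSet (rejectSet γ K) :=
  measurableSet_le measurable_const (by fun_prop)

theorem risk_thresholdRule (γ : Params) (m : ℕ) (K : ℝ) :
    risk γ (thresholdRule γ m K) = m * ((1 - γ.p) * γ.δ0 * γ.nullLaw.real (rejectSet γ K) +
      γ.p * γ.δA * γ.altLaw.real (rejectSet γ K)ᶜ) := by
  have hK := measurableSet_rejectSet γ K
  have hms (b : Bool) : MeasurableSet {y : Bool × ℝ | y.1 = b} :=
    measurable_fst (measurableSet_singleton b)
  have h0 (i : Fin m) : (γ.dataLaw m).real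
      {ω | (ω i).1 = false ∧ i ∈ thresholdRule γ m K fun j => (ω j).2} =
      (1 - γ.p) * γ.nullLaw.real (rejectSet γ K) := by
    rw [← γ.pairLaw_real_false hK]
    exact γ.dataLaw_real_coord i ((hms false).inter (measurable_snd hK))
  have h1 (i : Fin m) : (γ.dataLaw m).real
      {ω | (ω i).1 = true ∧ i ∉ thresholdRule γ m K fun j => (ω j).2} =
      γ.p * γ.altLaw.real (rejectSet γ K)ᶜ := by
    rw [← γ.pairLaw_real_true hK.compl]
    exact γ.dataLaw_real_coord i ((hms true).inter (measurable_snd hK.compl))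
  rw [risk_eq]
  simp only [h0, h1, Finset.sum_const, Finset.card_univ, Fintype.card_fin, nsmul_eq_mul]
  ring

/-- The oracle is a likelihood ratio test: taking logarithms of the weighted densities leaves an
inequality linear in `x ^ 2`, whose solution is the oracle threshold. -/
theorem gaussianPDFReal_oracle (γ : Params) (x : ℝ) :
    (1 - γ.p) * γ.δ0 * gaussianPDFReal 0 (Real.toNNReal (γ.σ ^ 2)) x ≤
      γ.p * γ.δA * gaussianPDFReal 0 (Real.toNNReal (γ.σ ^ 2 + γ.τ ^ 2)) x ↔
      x ∈ rejectSet γ (oracleThreshold γ) := by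
  have hσ := γ.σ_pos
  have hτ := γ.τ_pos
  have hp := γ.p_pos
  have hp1 : 0 < 1 - γ.p := by linarith [γ.p_lt_one]
  have hδ0 := γ.δ0_pos
  have hδA := γ.δA_pos
  have hs : 0 < γ.σ ^ 2 + γ.τ ^ 2 := by positivity
  have hf := γ.f_pos
  have hδ := γ.δ_pos
  rw [gaussianPDFReal, gaussianPDFReal, Real.coe_toNNReal _ (by positivity),
    Real.coe_toNNReal _ hs.le, rejectSet, Set.mem_ofPred_eq, oracleThreshold]
  rw [← Real.log_le_log_iff (by positivity) (by positivity)]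
  rw [Real.log_mul (by positivity) (by positivity), Real.log_mul (by positivity) (by positivity),
    Real.log_mul (by positivity) (by positivity), Real.log_mul (by positivity) (by positivity),
    Real.log_mul (by positivity) (by positivity), Real.log_mul (by positivity) (by positivity),
    Real.log_exp, Real.log_exp, Real.log_inv, Real.log_inv, Real.log_sqrt (by positivity),
    Real.log_sqrt (by positivity), Real.log_mul (x := 2 * Real.pi) (by positivity) (by positivity),
    Real.log_mul (x := 2 * Real.pi) (by positivity) (by positivity)]
  have h1 : Real.log ((γ.τ / γ.σ) ^ 2 + 1) =
      Real.log (γ.σ ^ 2 + γ.τ ^ 2) - Real.log (γ.σ ^ 2) := by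
    rw [← Real.log_div (by positivity) (by positivity)]
    congr 1
    field_simp
    ring
  have h2 : Real.log (γ.f * γ.δ) = Real.log (1 - γ.p) - Real.log γ.p +
      (Real.log γ.δ0 - Real.log γ.δA) := by
    rw [Real.log_mul hf.ne' hδ.ne', Params.f, Params.δ, Real.log_div hp1.ne' hp.ne',
      Real.log_div hδ0.ne' hδA.ne']
  rw [h1, h2, div_mul_eq_mul_div, div_le_iff₀ (by positivity), ← le_div_iff₀' hs,
    show x ^ 2 / γ.σ ^ 2 * γ.τ ^ 2 / (γ.σ ^ 2 + γ.τ ^ 2) =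
      x ^ 2 / γ.σ ^ 2 - x ^ 2 / (γ.σ ^ 2 + γ.τ ^ 2) by field_simp; ring,
    show -(x - 0) ^ 2 / (2 * γ.σ ^ 2) = - (x ^ 2 / γ.σ ^ 2) / 2 by rw [sub_zero]; field_simp,
    show -(x - 0) ^ 2 / (2 * (γ.σ ^ 2 + γ.τ ^ 2)) = - (x ^ 2 / (γ.σ ^ 2 + γ.τ ^ 2)) / 2 by
      rw [sub_zero]; field_simp]
  constructor <;> intro h <;> linarith

/-- Pointwise minimization: the Bayes oracle set minimizes the single-test risk. -/
theorem single_risk_oracle_le (γ : Params) {A : Set ℝ} (hA : MeasurableSet A) :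
    (1 - γ.p) * γ.δ0 * γ.nullLaw.real (rejectSet γ (oracleThreshold γ)) +
      γ.p * γ.δA * γ.altLaw.real (rejectSet γ (oracleThreshold γ))ᶜ ≤
    (1 - γ.p) * γ.δ0 * γ.nullLaw.real A + γ.p * γ.δA * γ.altLaw.real Aᶜ := by
  have hσ := γ.σ_pos
  have hτ := γ.τ_pos
  set B := rejectSet γ (oracleThreshold γ) with hB
  have hBm : MeasurableSet B := measurableSet_rejectSet _ _
  set g0 : ℝ → ℝ := fun x => (1 - γ.p) * γ.δ0 * gaussianPDFReal 0 (Real.toNNReal (γ.σ ^ 2)) x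
  set g1 : ℝ → ℝ :=
    fun x => γ.p * γ.δA * gaussianPDFReal 0 (Real.toNNReal (γ.σ ^ 2 + γ.τ ^ 2)) x
  have i0 : Integrable g0 := (integrable_gaussianPDFReal _ _).const_mul _
  have i1 : Integrable g1 := (integrable_gaussianPDFReal _ _).const_mul _
  have e0 (S : Set ℝ) : (1 - γ.p) * γ.δ0 * γ.nullLaw.real S = ∫ x in S, g0 x := by
    rw [integral_const_mul, measureReal_def, Params.nullLaw,
      gaussianReal_apply_eq_integral _ (by simp [hσ.ne']), ENNReal.toReal_ofReal]
    exact integral_nonneg fun x => gaussianPDFReal_nonneg _ _ _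
  have e1 (S : Set ℝ) : γ.p * γ.δA * γ.altLaw.real S = ∫ x in S, g1 x := by
    have : Real.toNNReal (γ.σ ^ 2 + γ.τ ^ 2) ≠ 0 := by
      simp only [ne_eq, Real.toNNReal_eq_zero, not_le]; positivity
    rw [integral_const_mul, measureReal_def, Params.altLaw,
      gaussianReal_apply_eq_integral _ this, ENNReal.toReal_ofReal]
    exact integral_nonneg fun x => gaussianPDFReal_nonneg _ _ _
  have key (S : Set ℝ) (hS : MeasurableSet S) :
      (∫ x in S, g0 x) + ∫ x in Sᶜ, g1 x = ∫ x, S.indicator g0 x + Sᶜ.indicator g1 x := by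
    rw [integral_add (i0.indicator hS) (i1.indicator hS.compl), integral_indicator hS,
      integral_indicator hS.compl]
  rw [e0, e0, e1, e1, key B hBm, key A hA]
  refine integral_mono ((i0.indicator hBm).add (i1.indicator hBm.compl))
    ((i0.indicator hA).add (i1.indicator hA.compl)) fun x => ?_
  have hx : g0 x ≤ g1 x ↔ x ∈ B := gaussianPDFReal_oracle γ x
  by_cases h1 : x ∈ B <;> by_cases h2 : x ∈ A <;> simp [h1, h2]
  · exact hx.2 h1
  · exact (not_le.1 (mt hx.1 h1)).le

/-- The Bayes oracle has the smallest Bayes risk among all measurable rules. -/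
theorem optRisk_le_risk (γ : Params) {m : ℕ} (T : TestRule m)
    (hT : ∀ i, MeasurableSet {x : Fin m → ℝ | i ∈ T x}) : optRisk γ m ≤ risk γ T := by
  rw [optRisk, risk_thresholdRule, risk_eq]
  set r := (1 - γ.p) * γ.δ0 * γ.nullLaw.real (rejectSet γ (oracleThreshold γ)) +
      γ.p * γ.δA * γ.altLaw.real (rejectSet γ (oracleThreshold γ))ᶜ
  have hsum : (m : ℝ) * r = ∑ _i : Fin m, r := by simp
  rw [hsum]
  refine Finset.sum_le_sum fun i _ => ?_
  have hproj : Measurable fun (ω : Fin m → Bool × ℝ) (j : Fin m) => (ω j).2 :=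
    measurable_pi_iff.2 fun j => measurable_snd.comp (measurable_pi_apply j)
  have hb (b : Bool) : MeasurableSet {ω : Fin m → Bool × ℝ | (ω i).1 = b} :=
    (measurable_fst.comp (measurable_pi_apply i)) (measurableSet_singleton b)
  have hS0 : MeasurableSet {ω : Fin m → Bool × ℝ | (ω i).1 = false ∧ i ∈ T fun j => (ω j).2} :=
    (hb false).inter (hproj (hT i))
  have hS1 : MeasurableSet {ω : Fin m → Bool × ℝ | (ω i).1 = true ∧ i ∉ T fun j => (ω j).2} :=
    (hb true).inter (hproj (hT i).compl)
  -- With the other observations frozen, the rule acts on test `i` as a single test with a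
  -- measurable rejection set, so the one-test bound applies inside the integral.
  rw [Params.dataLaw, pi_real_eq_integral_update _ i hS0, pi_real_eq_integral_update _ i hS1,
    ← integral_const_mul, ← integral_const_mul,
    ← integral_add ((integrable_real_update _ i hS0).const_mul _)
      ((integrable_real_update _ i hS1).const_mul _)]
  have hr : r = ∫ _ω : Fin m → Bool × ℝ, r ∂Measure.pi fun _ => γ.pairLaw := by simp
  rw [hr]
  refine integral_mono (integrable_const _)
    (((integrable_real_update _ i hS0).const_mul _).add
      ((integrable_real_update _ i hS1).const_mul _)) fun ω => ?_
  have hupd : Measurable fun x : ℝ => Function.update (fun j => (ω j).2) i x :=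
    measurable_update _
  have hA : MeasurableSet {x : ℝ | i ∈ T (Function.update (fun j => (ω j).2) i x)} :=
    hupd (hT i)
  have hcomp (y : Bool × ℝ) : (fun j => (Function.update ω i y j).2) =
      Function.update (fun j => (ω j).2) i y.2 := by
    ext j
    by_cases hj : j = i
    · subst hj; simp
    · simp [Function.update_of_ne hj]
  have h0 := γ.pairLaw_real_false hA
  have h1 := γ.pairLaw_real_true hA.compl
  simp only [Set.mem_ofPred_eq, Function.update_self, hcomp]
  simp only [Set.mem_compl_iff, Set.mem_ofPred_eq] at h0 h1
  rw [h0, h1]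
  have := single_risk_oracle_le γ hA
  calc r ≤ _ := this
    _ = _ := by ring

/-! ### Deterministic properties of the step-up procedure -/

section Combinatorics

open Finset Classical

variable {m : ℕ}

/-- The number of entries of `q` which are at most `t`. -/
def countLE (q : Fin m → ℝ) (t : ℝ) : ℕ := #{j | q j ≤ t}

theorem countLE_mono_right (q : Fin m → ℝ) {s t : ℝ} (h : s ≤ t) : countLE q s ≤ countLE q t :=
  card_le_card fun j hj => by
    simp only [mem_filter, mem_univ, true_and] at hj ⊢
    exact hj.trans h

theorem countLE_anti_left {q q' : Fin m → ℝ} (h : q ≤ q') (t : ℝ) : countLE q' t ≤ countLE q t :=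
  card_le_card fun j hj => by
    simp only [mem_filter, mem_univ, true_and] at hj ⊢
    exact (h j).trans hj

theorem countLE_le (q : Fin m → ℝ) (t : ℝ) : countLE q t ≤ m :=
  (card_le_univ _).trans (by simp)

theorem orderStat_le_iff (q : Fin m → ℝ) (k : Fin m) (t : ℝ) :
    orderStat q k ≤ t ↔ (k : ℕ) + 1 ≤ countLE q t := by
  have h := Tuple.lt_card_le_iff_apply_le_of_monotone (j := k) (a := t) (Tuple.monotone_sort q)
  have hc : #{i | (q ∘ Tuple.sort q) i ≤ t} = countLE q t :=
    card_bij (fun i _ => Tuple.sort q i) (by simp) (by simp)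
      fun b hb => ⟨(Tuple.sort q).symm b, by simpa using hb, by simp⟩
  rw [hc] at h
  exact h.symm

/-- The number of rejections of the step-up procedure at level `α` applied to the p-values `q`. -/
def stepUpNum (α : ℝ) (q : Fin m → ℝ) : ℕ :=
  Nat.findGreatest (fun k : ℕ => k ≤ countLE q (k * α / m)) m

theorem stepUpNum_spec (α : ℝ) (q : Fin m → ℝ) :
    stepUpNum α q ≤ countLE q (stepUpNum α q * α / m) :=
  -- The value `0` always qualifies, so the default of `Nat.findGreatest` is harmless and encodes no
  -- rejection.
  Nat.findGreatest_spec (P := fun k : ℕ => k ≤ countLE q (k * α / m)) (Nat.zero_le m)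
    (Nat.zero_le _)

theorem le_stepUpNum {α : ℝ} {q : Fin m → ℝ} {k : ℕ} (h : k ≤ countLE q (k * α / m)) :
    k ≤ stepUpNum α q :=
  Nat.le_findGreatest (h.trans (countLE_le _ _)) h

theorem stepUpNum_le (α : ℝ) (q : Fin m → ℝ) : stepUpNum α q ≤ m := Nat.findGreatest_le m

/-- Smaller p-values raise every count, so a number of rejections that is feasible for `q'` stays
feasible for `q`. -/
theorem stepUpNum_anti {α : ℝ} {q q' : Fin m → ℝ} (h : q ≤ q') :
    stepUpNum α q' ≤ stepUpNum α q :=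
  le_stepUpNum ((stepUpNum_spec α q').trans (countLE_anti_left h _))

/-- Any feasible `k` suffices, not just the largest one, and sorting disappears. Type II bounds only
have to exhibit a `k`, and measurability becomes a countable union. -/
theorem mem_bhRule_iff (γ : Params) {α : ℝ} (hα : 0 ≤ α) (x : Fin m → ℝ) (i : Fin m) :
    i ∈ bhRule γ m α x ↔ ∃ k : ℕ, 1 ≤ k ∧
      k ≤ countLE (fun j => pValue γ (x j)) (k * α / m) ∧ pValue γ (x i) ≤ k * α / m := by
  set q : Fin m → ℝ := fun j => pValue γ (x j) with hq
  have hmono {k l : ℕ} (h : k ≤ l) : (k : ℝ) * α / m ≤ l * α / m := by gcongr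
  constructor
  · rintro ⟨k, hk, hi⟩
    refine ⟨k + 1, by omega, ?_, ?_⟩
    · have := hk.1
      rw [Set.mem_ofPred_eq, orderStat_le_iff] at this
      exact_mod_cast this
    · exact_mod_cast hi.trans hk.1
  · rintro ⟨k, hk1, hk, hi⟩
    have hkm : k ≤ m := hk.trans (countLE_le _ _)
    set K : Set (Fin m) := {k : Fin m | orderStat q k ≤ ((k : ℕ) + 1 : ℝ) * α / m} with hK
    have hmem : (⟨k - 1, by omega⟩ : Fin m) ∈ K := by
      rw [hK, Set.mem_ofPred_eq, orderStat_le_iff]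
      have : ((k - 1 : ℕ) : ℝ) + 1 = k := by exact_mod_cast Nat.sub_add_cancel hk1
      simp only [this]
      omega
    obtain ⟨l, hl, hlmax⟩ := K.toFinite.exists_maximal ⟨_, hmem⟩
    have hgr : IsGreatest K l := ⟨hl, fun z hz => (le_total z l).elim id fun h => hlmax hz h⟩
    refine ⟨l, hgr, ?_⟩
    have hkl : k ≤ l + 1 := by
      have := hgr.2 hmem
      rw [Fin.le_def] at this
      simp only at this
      omega
    -- If `q i` exceeded the order statistic at `l` while lying below the bound, `i` would be one
    -- more entry counted there, making index `l + 1` feasible against the maximality of `l`.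
    by_contra hcon
    rw [not_le] at hcon
    have hil : q i ≤ ((l : ℕ) + 1 : ℝ) * α / m := by
      refine hi.trans ?_
      exact_mod_cast hmono hkl
    have hcount : (l : ℕ) + 2 ≤ countLE q (((l : ℕ) + 1 : ℝ) * α / m) := by
      have h1 : (l : ℕ) + 1 ≤ countLE q (orderStat q l) := (orderStat_le_iff q l _).1 le_rfl
      refine Nat.succ_le_of_lt (lt_of_le_of_lt h1 (card_lt_card ?_))
      refine (ssubset_iff_of_subset fun j hj => ?_).2 ⟨i, ?_, ?_⟩
      · simp only [mem_filter, mem_univ, true_and] at hj ⊢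
        exact hj.trans hl
      · simpa using hil
      · simpa using hcon
    have hlm : (l : ℕ) + 1 < m := by
      have := countLE_le q (((l : ℕ) + 1 : ℝ) * α / m)
      omega
    have : (⟨l + 1, hlm⟩ : Fin m) ∈ K := by
      rw [hK, Set.mem_ofPred_eq, orderStat_le_iff]
      refine hcount.trans (countLE_mono_right _ ?_)
      have := hmono (Nat.le_succ (l + 1))
      push_cast at this ⊢
      exact this
    have := hgr.2 this
    rw [Fin.le_def] at this
    simp only at this
    omega

/-- The vector `q` with the entries indexed by `S` set to zero. -/
def zeroOn (S : Finset (Fin m)) (q : Fin m → ℝ) : Fin m → ℝ := fun j => if j ∈ S then 0 else q j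

theorem zeroOn_insert_le (S : Finset (Fin m)) {q : Fin m → ℝ} (hq : 0 ≤ q) (j : Fin m) :
    zeroOn (insert j S) q ≤ zeroOn S q := by
  intro l
  unfold zeroOn
  by_cases h1 : l ∈ S
  · simp [h1]
  · by_cases h2 : l = j
    · simp only [mem_insert, h2, true_or, if_true]
      split_ifs
      · exact le_rfl
      · exact hq j
    · simp [h1, h2]

theorem zeroOn_insert_update (S : Finset (Fin m)) (q : Fin m → ℝ) (j : Fin m) (t : ℝ) :
    zeroOn (insert j S) (Function.update q j t) = zeroOn (insert j S) q := by
  ext l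
  unfold zeroOn
  by_cases h2 : l = j
  · simp [h2]
  · simp [h2]

/-- Zeroing `p_i` only increases counts, so any `k` witnessing the rejection is at most the number
of rejections with `p_i = 0`. That number does not depend on `p_i`, which decouples the two sides.
-/
theorem le_stepUpNum_of_mem_bhRule {γ : Params} {α : ℝ} (hα : 0 ≤ α) {x : Fin m → ℝ} {i : Fin m}
    (hq : 0 ≤ fun j => pValue γ (x j)) (h : i ∈ bhRule γ m α x) :
    pValue γ (x i) ≤ stepUpNum α (zeroOn {i} fun j => pValue γ (x j)) * α / m := by
  obtain ⟨k, -, hk, hi⟩ := (mem_bhRule_iff γ hα x i).1 h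
  refine hi.trans ?_
  have hle : zeroOn {i} (fun j => pValue γ (x j)) ≤ fun j => pValue γ (x j) := by
    have := zeroOn_insert_le ∅ hq i
    rwa [insert_empty_eq, show zeroOn ∅ (fun j => pValue γ (x j)) = fun j => pValue γ (x j) by
      ext; simp [zeroOn]] at this
  have := le_stepUpNum (α := α) (hk.trans (countLE_anti_left hle _))
  gcongr

/-- Every rejected entry which is not set to zero is small relative to the number of rejections
that would be made if it were set to zero. -/
theorem stepUpNum_zeroOn_le {α : ℝ} (hα : 0 ≤ α) (S : Finset (Fin m)) {q : Fin m → ℝ}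
    (hq : 0 ≤ q) :
    (stepUpNum α (zeroOn S q) : ℝ) ≤ #S + ∑ j ∈ Sᶜ,
      Set.indicator {q | q j ≤ stepUpNum α (zeroOn (insert j S) q) * α / m} 1 q := by
  set R := stepUpNum α (zeroOn S q) with hR
  have h1 : R ≤ #S + #{j ∈ Sᶜ | q j ≤ stepUpNum α (zeroOn (insert j S) q) * α / m} := by
    refine (stepUpNum_spec α (zeroOn S q)).trans ?_
    refine (card_le_card fun j hj => ?_).trans (card_union_le _ _)
    simp only [mem_filter, mem_univ, true_and, mem_union, mem_compl] at hj ⊢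
    by_cases hjS : j ∈ S
    · exact Or.inl hjS
    · refine Or.inr ⟨hjS, ?_⟩
      rw [zeroOn, if_neg hjS] at hj
      refine hj.trans ?_
      have := stepUpNum_anti (α := α) (zeroOn_insert_le S hq j)
      gcongr
  calc (R : ℝ) ≤ #S + #{j ∈ Sᶜ | q j ≤ stepUpNum α (zeroOn (insert j S) q) * α / m} := by
        exact_mod_cast h1
    _ = _ := by
        congr 1
        rw [card_filter]
        push_cast
        refine sum_congr rfl fun j _ => ?_
        simp [Set.indicator_apply]

theorem measurable_countLE (t : ℝ) : Measurable fun q : Fin m → ℝ => countLE q t := by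
  have : (fun q : Fin m → ℝ => countLE q t) = fun q => ∑ j, if q j ≤ t then 1 else 0 := by
    ext q
    rw [countLE, card_filter]
  rw [this]
  refine measurable_fun_sum _ fun j _ => Measurable.ite ?_ measurable_const measurable_const
  exact measurableSet_le (measurable_pi_apply j) measurable_const

theorem measurable_stepUpNum (α : ℝ) : Measurable (stepUpNum (m := m) α) :=
  measurable_findGreatest fun _ _ =>
    measurableSet_le measurable_const (measurable_countLE _)

theorem measurable_zeroOn (S : Finset (Fin m)) : Measurable (zeroOn S) := by
  refine measurable_pi_iff.2 fun j => ?_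
  unfold zeroOn
  split_ifs
  · exact measurable_const
  · exact measurable_pi_apply j

end Combinatorics

/-! ### Expected number of rejections -/

section ExpectedRejections

open Classical

variable {E : Type*} [MeasurableSpace E] {m : ℕ} (μ : Measure E) {q : E → ℝ}

/-- The expected number of rejections of the step-up procedure when the p-values indexed by `S`
are set to zero. -/
def meanStepUp (q : E → ℝ) (m : ℕ) (α : ℝ) (S : Finset (Fin m)) : ℝ :=
  ∫ ω : Fin m → E, (stepUpNum α (zeroOn S fun j => q (ω j)) : ℝ) ∂Measure.pi fun _ => μ

theorem measurable_stepUpNum_comp (hq : Measurable q) (α : ℝ) (S : Finset (Fin m)) :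
    Measurable fun ω : Fin m → E => (stepUpNum α (zeroOn S fun j => q (ω j)) : ℝ) := by
  have h : Measurable fun (ω : Fin m → E) (j : Fin m) => q (ω j) :=
    measurable_pi_iff.2 fun j => hq.comp (measurable_pi_apply j)
  exact measurable_from_top.comp ((measurable_stepUpNum α).comp ((measurable_zeroOn S).comp h))

variable [IsProbabilityMeasure μ]

theorem integrable_stepUpNum_comp (hq : Measurable q) (α : ℝ) (S : Finset (Fin m)) :
    Integrable (fun ω : Fin m → E => (stepUpNum α (zeroOn S fun j => q (ω j)) : ℝ))
      (Measure.pi fun _ => μ) := by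
  refine Integrable.of_bound (C := m) (measurable_stepUpNum_comp hq α S).aestronglyMeasurable
    (ae_of_all _ fun ω => ?_)
  rw [Real.norm_of_nonneg (by positivity)]
  exact_mod_cast stepUpNum_le _ _

/-- If the law of a p-value is bounded by `t ↦ a (b + t)`, so is the probability that it is small
relative to the number of rejections obtained when it is set to zero. -/
theorem real_le_stepUpNum_insert {P : Set E} (hP : MeasurableSet P)
    (hq : Measurable q) {a b : ℝ} (hab : ∀ t, 0 ≤ t → μ.real {y | y ∈ P ∧ q y ≤ t} ≤ a * (b + t))
    {α : ℝ} (hα : 0 ≤ α) (S : Finset (Fin m)) (j : Fin m) :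
    (Measure.pi fun _ => μ).real {ω : Fin m → E | ω j ∈ P ∧
      q (ω j) ≤ stepUpNum α (zeroOn (insert j S) fun l => q (ω l)) * α / m} ≤
      a * (b + meanStepUp μ q m α (insert j S) * α / m) := by
  have hms : MeasurableSet {ω : Fin m → E | ω j ∈ P ∧
      q (ω j) ≤ stepUpNum α (zeroOn (insert j S) fun l => q (ω l)) * α / m} := by
    refine MeasurableSet.inter (measurable_pi_apply (X := fun _ : Fin m => E) j hP) ?_
    exact measurableSet_le (hq.comp (measurable_pi_apply j))
      (((measurable_stepUpNum_comp hq α _).mul_const _).div_const _)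
  have hi := integrable_stepUpNum_comp μ hq α (insert j S)
  have hi' := ((hi.mul_const α).div_const (m : ℝ))
  rw [pi_real_eq_integral_update μ j hms]
  have hrhs : a * (b + meanStepUp μ q m α (insert j S) * α / m) =
      ∫ ω : Fin m → E, a * (b + stepUpNum α (zeroOn (insert j S) fun l => q (ω l)) * α / m)
        ∂Measure.pi fun _ => μ := by
    rw [integral_const_mul, integral_add (integrable_const _) hi', integral_div,
      integral_mul_const, meanStepUp]
    simp
  rw [hrhs]
  refine integral_mono (integrable_real_update μ j hms)
    (((integrable_const _).add hi').const_mul a) fun ω => ?_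
  have hcomp (y : E) : (fun l => q (Function.update ω j y l)) =
      Function.update (fun l => q (ω l)) j (q y) := by
    ext l
    by_cases hl : l = j
    · subst hl; simp
    · simp [Function.update_of_ne hl]
  simp only [Set.mem_ofPred_eq, Function.update_self, hcomp, zeroOn_insert_update]
  exact hab _ (by positivity)

/-- Count the rejected indices outside `S`: each has a p-value bounded by a multiple of the
rejection number with that index zeroed as well, which is independent of it. The result is a
recursion from `S` to larger sets. -/
theorem meanStepUp_le_add_sum (hq : Measurable q) (hq0 : ∀ y, 0 ≤ q y) {b : ℝ}
    (hb : ∀ t, 0 ≤ t → μ.real {y | q y ≤ t} ≤ b + t) {α : ℝ} (hα : 0 ≤ α) (S : Finset (Fin m)) :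
    meanStepUp μ q m α S ≤
      S.card + ∑ j ∈ Sᶜ, (b + meanStepUp μ q m α (insert j S) * α / m) := by
  have hproj : Measurable fun (ω : Fin m → E) (j : Fin m) => q (ω j) :=
    measurable_pi_iff.2 fun j => hq.comp (measurable_pi_apply j)
  have hms (j : Fin m) : MeasurableSet {ω : Fin m → E |
      q (ω j) ≤ stepUpNum α (zeroOn (insert j S) fun l => q (ω l)) * α / m} :=
    measurableSet_le (hq.comp (measurable_pi_apply j))
      (((measurable_stepUpNum_comp hq α _).mul_const _).div_const _)
  have hint (j : Fin m) : Integrable (Set.indicator {ω : Fin m → E |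
      q (ω j) ≤ stepUpNum α (zeroOn (insert j S) fun l => q (ω l)) * α / m} (1 : (Fin m → E) → ℝ))
      (Measure.pi fun _ => μ) := (integrable_const (1 : ℝ)).indicator (hms j)
  calc meanStepUp μ q m α S
      ≤ ∫ ω : Fin m → E, ((S.card : ℝ) + ∑ j ∈ Sᶜ, Set.indicator {ω : Fin m → E |
          q (ω j) ≤ stepUpNum α (zeroOn (insert j S) fun l => q (ω l)) * α / m} 1 ω)
          ∂Measure.pi fun _ => μ := by
        refine integral_mono (integrable_stepUpNum_comp μ hq α S)
          ((integrable_const _).add (integrable_finsetSum _ fun j _ => hint j)) fun ω => ?_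
        exact stepUpNum_zeroOn_le hα S (q := fun j => q (ω j)) fun j => hq0 _
    _ = S.card + ∑ j ∈ Sᶜ, (Measure.pi fun _ => μ).real {ω : Fin m → E |
          q (ω j) ≤ stepUpNum α (zeroOn (insert j S) fun l => q (ω l)) * α / m} := by
        rw [integral_add (integrable_const _) (integrable_finsetSum _ fun j _ => hint j),
          integral_finsetSum _ fun j _ => hint j]
        simp [integral_indicator_one (hms _)]
    _ ≤ _ := by
        gcongr with j hj
        have := real_le_stepUpNum_insert μ MeasurableSet.univ hq (a := 1) (b := b)
          (by simpa using hb) hα S j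
        simpa using this

/-- The expected number of rejections is bounded by a multiple of the number of false null
hypotheses, plus a constant. -/
theorem meanStepUp_le (hq : Measurable q) (hq0 : ∀ y, 0 ≤ q y) {b : ℝ} (hb0 : 0 ≤ b)
    (hb : ∀ t, 0 ≤ t → μ.real {y | q y ≤ t} ≤ b + t) {α : ℝ} (hα : 0 ≤ α) (hα1 : α < 1)
    (S : Finset (Fin m)) :
    meanStepUp μ q m α S ≤ (S.card + m * b) / (1 - α) + α / (1 - α) ^ 2 := by
  induction h : Sᶜ.card generalizing S with
  | zero =>
    refine (meanStepUp_le_add_sum μ hq hq0 hb hα S).trans ?_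
    rw [Finset.card_eq_zero.1 h, Finset.sum_empty, add_zero]
    have h1 : 0 < 1 - α := by linarith
    have h2 : (S.card : ℝ) ≤ (S.card + m * b) / (1 - α) := by
      rw [le_div_iff₀ h1]
      have : 0 ≤ (S.card : ℝ) * α := by positivity
      have : 0 ≤ m * b := by positivity
      linarith
    have : 0 ≤ α / (1 - α) ^ 2 := by positivity
    linarith
  | succ n ih =>
    have h1 : 0 < 1 - α := by linarith
    have hm : 0 < (m : ℝ) := by
      have : Sᶜ.card ≤ m := (Finset.card_le_univ _).trans (by simp)
      have : 0 < m := by omega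
      exact_mod_cast this
    refine (meanStepUp_le_add_sum μ hq hq0 hb hα S).trans ?_
    -- `X` is the asserted bound for a set with one more element. The constant `α / (1 - α) ^ 2` is
    -- the fixed point of the recursion: `α / (1 - α) + α · α / (1 - α) ^ 2` equals it.
    set X : ℝ := (S.card + 1 + m * b) / (1 - α) + α / (1 - α) ^ 2 with hX
    have hX0 : 0 ≤ X := by positivity
    have hstep (j) (hj : j ∈ Sᶜ) : meanStepUp μ q m α (insert j S) ≤ X := by
      have hjS : j ∉ S := by simpa using hj
      have hcard : (insert j S).card = S.card + 1 := Finset.card_insert_of_notMem hjS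
      have := ih (insert j S) (by
        rw [Finset.card_compl, hcard]
        rw [Finset.card_compl] at h
        omega)
      rw [hcard] at this
      push_cast at this
      exact this
    have hcard : (Sᶜ.card : ℝ) ≤ m := by
      have : Sᶜ.card ≤ m := (Finset.card_le_univ _).trans (by simp)
      exact_mod_cast this
    calc (S.card : ℝ) + ∑ j ∈ Sᶜ, (b + meanStepUp μ q m α (insert j S) * α / m)
        ≤ S.card + ∑ _j ∈ Sᶜ, (b + X * α / m) := by
          gcongr with j hj
          exact hstep j hj
      _ = S.card + Sᶜ.card * (b + X * α / m) := by simp [mul_add]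
      _ ≤ S.card + m * (b + X * α / m) := by gcongr
      _ = (S.card + m * b) / (1 - α) + α / (1 - α) ^ 2 := by
          rw [hX]
          field_simp
          ring

end ExpectedRejections

/-! ### Error probabilities of threshold rules and p-values -/

theorem gaussianReal_map_mul (s : ℝ) :
    (gaussianReal 0 1).map (s * ·) = gaussianReal 0 (Real.toNNReal (s ^ 2)) := by
  rw [gaussianReal_map_const_mul, mul_zero, mul_one]
  congr 1
  ext
  simp [sq_nonneg]

theorem normal_real_le_abs {s : ℝ} (hs : 0 < s) (c σ : ℝ) (hσ : 0 < σ) :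
    (gaussianReal 0 (Real.toNNReal (s ^ 2))).real {x | c ≤ |x| / σ} = normalTail (c * σ / s) := by
  rw [← gaussianReal_map_mul, map_measureReal_apply (measurable_const_mul s)
    (measurableSet_le measurable_const (by fun_prop)), normalTail]
  congr 1
  ext z
  simp only [Set.mem_preimage, Set.mem_ofPred_eq]
  rw [abs_mul, abs_of_pos hs, le_div_iff₀ hσ, div_le_iff₀' hs]

namespace Params

variable (γ : Params)

theorem nullLaw_real_le_abs (c : ℝ) : γ.nullLaw.real {x | c ≤ |x| / γ.σ} = normalTail c := by
  have hσ := γ.σ_pos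
  rw [nullLaw, normal_real_le_abs hσ c _ hσ, mul_div_assoc, div_self hσ.ne', mul_one]

theorem altLaw_real_le_abs (c : ℝ) :
    γ.altLaw.real {x | c ≤ |x| / γ.σ} = normalTail (c / √(1 + γ.u)) := by
  have hσ := γ.σ_pos
  have hτ := γ.τ_pos
  have hs : 0 < √(γ.σ ^ 2 + γ.τ ^ 2) := by positivity
  have hv : γ.σ ^ 2 + γ.τ ^ 2 = √(γ.σ ^ 2 + γ.τ ^ 2) ^ 2 := (Real.sq_sqrt (by positivity)).symm
  rw [altLaw, hv, normal_real_le_abs hs c _ hσ]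
  congr 1
  have h1 : √(γ.σ ^ 2 + γ.τ ^ 2) = γ.σ * √(1 + γ.u) := by
    have : γ.σ ^ 2 + γ.τ ^ 2 = γ.σ ^ 2 * (1 + γ.u) := by
      rw [u]; field_simp
    rw [this, Real.sqrt_mul (by positivity), Real.sqrt_sq hσ.le]
  have hu := γ.u_pos
  rw [h1]
  field_simp

/-- The type II error probability of the fixed threshold rule with threshold `c ^ 2`. -/
def typeTwo (c : ℝ) : ℝ := 1 - normalTail (c / √(1 + γ.u))

theorem typeTwo_nonneg (c : ℝ) : 0 ≤ γ.typeTwo c := one_sub_normalTail_nonneg _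

theorem typeTwo_le_one (c : ℝ) : γ.typeTwo c ≤ 1 := by
  have := normalTail_nonneg (c / √(1 + γ.u))
  unfold typeTwo; linarith

theorem typeTwo_mono : Monotone γ.typeTwo := fun c d h => by
  unfold typeTwo
  have := normalTail_antitone (div_le_div_of_nonneg_right h (Real.sqrt_nonneg (1 + γ.u)))
  linarith

theorem typeTwo_mul_le {r c : ℝ} (hr : 1 ≤ r) (hc : 0 ≤ c) :
    γ.typeTwo (r * c) ≤ r * γ.typeTwo c := by
  unfold typeTwo
  rw [mul_div_assoc]
  exact one_sub_normalTail_mul_le hr (by positivity)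

theorem measurableSet_le_abs (c : ℝ) : MeasurableSet {x : ℝ | c ≤ |x| / γ.σ} :=
  measurableSet_le measurable_const (by fun_prop)

end Params

theorem rejectSet_sq (γ : Params) {c : ℝ} (hc : 0 ≤ c) :
    rejectSet γ (c ^ 2) = {x | c ≤ |x| / γ.σ} := by
  ext x
  have h : x ^ 2 / γ.σ ^ 2 = (|x| / γ.σ) ^ 2 := by rw [div_pow, sq_abs]
  have := γ.σ_pos
  rw [rejectSet, Set.mem_ofPred_eq, Set.mem_ofPred_eq, h,
    pow_le_pow_iff_left₀ hc (by positivity) two_ne_zero]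

theorem risk_thresholdRule_sq (γ : Params) (m : ℕ) {c : ℝ} (hc : 0 ≤ c) :
    risk γ (thresholdRule γ m (c ^ 2)) =
      m * γ.p * γ.δA * (γ.f * γ.δ * normalTail c + γ.typeTwo c) := by
  rw [risk_thresholdRule, rejectSet_sq γ hc, γ.nullLaw_real_le_abs,
    measureReal_compl (γ.measurableSet_le_abs c), γ.altLaw_real_le_abs, probReal_univ,
    Params.typeTwo, Params.f, Params.δ]
  have := γ.p_pos.ne'
  have := γ.δA_pos.ne'
  field_simp

theorem bfdr_sq (γ : Params) {c : ℝ} (hc : 0 ≤ c) :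
    bfdr γ (c ^ 2) = (1 - γ.p) * normalTail c /
      ((1 - γ.p) * normalTail c + γ.p * (1 - γ.typeTwo c)) := by
  have hA := γ.measurableSet_le_abs c
  have hS : {y : Bool × ℝ | c ^ 2 ≤ y.2 ^ 2 / γ.σ ^ 2} = {y | y.2 ∈ {x : ℝ | c ≤ |x| / γ.σ}} := by
    rw [← rejectSet_sq γ hc]; rfl
  have hA' : MeasurableSet {y : Bool × ℝ | y.2 ∈ {x : ℝ | c ≤ |x| / γ.σ}} := measurable_snd hA
  rw [bfdr, hS, cond_real_apply _ hA', γ.pairLaw_real_snd hA,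
    show {y : Bool × ℝ | y.2 ∈ {x : ℝ | c ≤ |x| / γ.σ}} ∩ {y | y.1 = false} =
      {y | y.1 = false ∧ y.2 ∈ {x : ℝ | c ≤ |x| / γ.σ}} from Set.inter_comm _ _,
    γ.pairLaw_real_false hA, γ.nullLaw_real_le_abs, γ.altLaw_real_le_abs, Params.typeTwo,
    sub_sub_cancel, inv_mul_eq_div]

theorem pValue_eq (γ : Params) (x : ℝ) : pValue γ x = normalTail (|x| / γ.σ) :=
  two_mul_one_sub_cdf (div_nonneg (abs_nonneg x) γ.σ_pos.le)

theorem pValue_nonneg (γ : Params) (x : ℝ) : 0 ≤ pValue γ x := by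
  rw [pValue_eq]; exact normalTail_nonneg _

theorem measurable_pValue (γ : Params) : Measurable (pValue γ) := by
  have : pValue γ = fun x => normalTail (|x| / γ.σ) := funext (pValue_eq γ)
  rw [this]
  exact normalTail_antitone.measurable.comp (by fun_prop)

theorem nullLaw_real_pValue_le (γ : Params) {t : ℝ} (ht : 0 ≤ t) :
    γ.nullLaw.real {x | pValue γ x ≤ t} ≤ t := by
  have hσ := γ.σ_pos
  rw [Params.nullLaw, ← gaussianReal_map_mul, map_measureReal_apply (measurable_const_mul _)
    (measurableSet_le (measurable_pValue γ) measurable_const)]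
  convert gaussianReal_normalTail_le ht using 2
  ext z
  simp only [Set.mem_preimage, Set.mem_ofPred_eq, pValue_eq]
  rw [abs_mul, abs_of_pos hσ, mul_div_cancel_left₀ _ hσ.ne']

theorem measurableSet_bhRule (γ : Params) (m : ℕ) {α : ℝ} (hα : 0 ≤ α) (i : Fin m) :
    MeasurableSet {x : Fin m → ℝ | i ∈ bhRule γ m α x} := by
  simp only [mem_bhRule_iff γ hα, Set.ofPred_exists]
  have hproj : Measurable fun (x : Fin m → ℝ) (j : Fin m) => pValue γ (x j) :=
    measurable_pi_iff.2 fun j => (measurable_pValue γ).comp (measurable_pi_apply j)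
  refine MeasurableSet.iUnion fun k => ?_
  refine (MeasurableSet.const _).inter (MeasurableSet.inter ?_ ?_)
  · exact measurableSet_le measurable_const ((measurable_countLE _).comp hproj)
  · exact measurableSet_le ((measurable_pValue γ).comp (measurable_pi_apply i)) measurable_const

/-- Every alternative is counted as small and null p-values are superuniform; this supplies `b = p`
in `meanStepUp_le`. -/
theorem pairLaw_real_pValue_le (γ : Params) {t : ℝ} (ht : 0 ≤ t) :
    γ.pairLaw.real {y | pValue γ y.2 ≤ t} ≤ γ.p + t := by
  have hp := γ.p_pos
  have hp1 := γ.p_lt_one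
  have hA : MeasurableSet {x | pValue γ x ≤ t} :=
    measurableSet_le (measurable_pValue γ) measurable_const
  have h := γ.pairLaw_real_snd hA
  have h1 := nullLaw_real_pValue_le γ ht
  have h2 : γ.altLaw.real {x | pValue γ x ≤ t} ≤ 1 := measureReal_le_one
  simp only [Set.mem_ofPred_eq] at h
  rw [h]
  have h3 : (1 - γ.p) * γ.nullLaw.real {x | pValue γ x ≤ t} ≤ 1 * t := by
    gcongr
    linarith
  have h4 : γ.p * γ.altLaw.real {x | pValue γ x ≤ t} ≤ γ.p * 1 := by gcongr
  linarith

/-! ### Type I and type II errors of the Benjamini–Hochberg procedure -/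

/-- The probability that the Benjamini–Hochberg procedure makes a type I error on a given test. -/
theorem bhRule_typeOne_le (γ : Params) {m : ℕ} {α : ℝ} (hα : 0 ≤ α) (hα1 : α < 1) (i : Fin m) :
    (γ.dataLaw m).real {ω | (ω i).1 = false ∧ i ∈ bhRule γ m α fun j => (ω j).2} ≤
      (1 - γ.p) * (((1 + m * γ.p) / (1 - α) + α / (1 - α) ^ 2) * α / m) := by
  have hp1 : 0 < 1 - γ.p := by linarith [γ.p_lt_one]
  have hq : Measurable fun y : Bool × ℝ => pValue γ y.2 := (measurable_pValue γ).comp measurable_snd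
  have hP : MeasurableSet {y : Bool × ℝ | y.1 = false} :=
    measurable_fst (measurableSet_singleton false)
  have h1 := real_le_stepUpNum_insert γ.pairLaw (m := m) (a := 1 - γ.p) (b := 0) hP hq (fun t ht => by
    have hA : MeasurableSet {x | pValue γ x ≤ t} :=
      measurableSet_le (measurable_pValue γ) measurable_const
    have := γ.pairLaw_real_false hA
    simp only [Set.mem_ofPred_eq] at this ⊢
    rw [this, zero_add]
    gcongr
    exact nullLaw_real_pValue_le γ ht) hα ∅ i
  have h2 := meanStepUp_le γ.pairLaw (m := m) hq (fun y => pValue_nonneg γ _) γ.p_pos.le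
    (fun t ht => pairLaw_real_pValue_le γ ht) hα hα1 (insert i ∅)
  simp only [insert_empty_eq, Finset.card_singleton, Nat.cast_one, zero_add] at h1 h2
  refine le_trans (measureReal_mono fun ω hω => ?_) (h1.trans ?_)
  · exact ⟨hω.1, le_stepUpNum_of_mem_bhRule hα (fun j => pValue_nonneg γ _) hω.2⟩
  · gcongr

/-- The integral is `1 - (1 - e⁻¹) μ(A)`; since `e⁻¹ ≤ 1 / 2` it is at most `1 - μ(A) / 2`, hence at
most the exponential. -/
theorem integral_exp_neg_indicator {E : Type*} [MeasurableSpace E] (μ : Measure E)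
    [IsProbabilityMeasure μ] {A : Set E} (hA : MeasurableSet A) :
    ∫ y, Real.exp (-(A.indicator 1 y)) ∂μ ≤ Real.exp (-(μ.real A / 2)) := by
  have h1 : (fun y => Real.exp (-(A.indicator 1 y))) =
      fun y => 1 - (1 - Real.exp (-1)) * A.indicator 1 y := by
    ext y
    by_cases hy : y ∈ A <;> simp [hy]
  have h2 : Integrable (A.indicator (1 : E → ℝ)) μ := (integrable_const (1 : ℝ)).indicator hA
  rw [h1, integral_sub (integrable_const _) (h2.const_mul _), integral_const_mul,
    integral_indicator_one hA]
  have h3 : Real.exp (-1) ≤ 1 / 2 := by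
    have := Real.exp_neg_one_lt_d9
    linarith
  have h4 : 0 ≤ μ.real A := measureReal_nonneg
  have h5 := Real.add_one_le_exp (-(μ.real A / 2))
  simp only [integral_const, probReal_univ, smul_eq_mul, mul_one]
  nlinarith

/-- Chernoff bound for the number of coordinates other than `i` lying in `A`, jointly with an event
concerning the coordinate `i`. -/
theorem pi_real_card_lt_le {E : Type*} [MeasurableSpace E] (μ : Measure E)
    [IsProbabilityMeasure μ] {m : ℕ} (i : Fin m) {A B : Set E} (hA : MeasurableSet A)
    (hB : MeasurableSet B) (n : ℝ) :
    (Measure.pi fun _ => μ).real {ω : Fin m → E | ω i ∈ B ∧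
      ∑ j ∈ Finset.univ.erase i, A.indicator (1 : E → ℝ) (ω j) ≤ n} ≤
      μ.real B * Real.exp (n - (m - 1) * (μ.real A / 2)) := by
  classical
  -- Exponential Markov inequality with the event at coordinate `i` kept as an indicator factor, so
  -- that the expectation factorizes.
  set g : Fin m → E → ℝ := fun j y =>
    if j = i then B.indicator 1 y else Real.exp (-(A.indicator 1 y)) with hg
  have hgm (j : Fin m) : Measurable (g j) := by
    by_cases hj : j = i
    · simp only [hg, hj, if_true]
      exact measurable_one.indicator hB
    · simp only [hg, hj, if_false]
      exact Real.measurable_exp.comp (measurable_one.indicator hA).neg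
  have hg0 (j : Fin m) (y : E) : 0 ≤ g j y := by
    simp only [hg]
    split_ifs
    · exact Set.indicator_nonneg (fun _ _ => zero_le_one) y
    · positivity
  have hg1 (j : Fin m) (y : E) : g j y ≤ 1 := by
    simp only [hg]
    split_ifs
    · exact Set.indicator_le_self' (fun _ _ => zero_le_one) y
    · refine Real.exp_le_one_iff.2 (neg_nonpos.2 ?_)
      exact Set.indicator_nonneg (fun _ _ => zero_le_one) y
  have hmeas (C : Set E) (hC : MeasurableSet C) (j : Fin m) :
      Measurable fun ω : Fin m → E => C.indicator (1 : E → ℝ) (ω j) :=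
    (measurable_one.indicator hC).comp (measurable_pi_apply j)
  have hS : MeasurableSet {ω : Fin m → E | ω i ∈ B ∧
      ∑ j ∈ Finset.univ.erase i, A.indicator (1 : E → ℝ) (ω j) ≤ n} :=
    MeasurableSet.inter (measurable_pi_apply (X := fun _ : Fin m => E) i hB)
      (measurableSet_le (Finset.measurable_fun_sum _ fun j _ => hmeas A hA j) measurable_const)
  have hint : Integrable (fun ω : Fin m → E => Real.exp n * ∏ j, g j (ω j))
      (Measure.pi fun _ => μ) := by
    refine Integrable.const_mul (Integrable.of_bound (C := 1) ?_ (ae_of_all _ fun ω => ?_)) _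
    · exact (Finset.measurable_fun_prod _ fun j _ =>
        (hgm j).comp (measurable_pi_apply j)).aestronglyMeasurable
    · rw [Real.norm_of_nonneg (Finset.prod_nonneg fun j _ => hg0 _ _)]
      exact Finset.prod_le_one (fun j _ => hg0 _ _) fun j _ => hg1 _ _
  have hprod (ω : Fin m → E) : ∏ j, g j (ω j) = B.indicator 1 (ω i) *
      Real.exp (-∑ j ∈ Finset.univ.erase i, A.indicator (1 : E → ℝ) (ω j)) := by
    rw [← Finset.mul_prod_erase _ _ (Finset.mem_univ i), ← Finset.sum_neg_distrib, Real.exp_sum]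
    congr 1
    · simp [hg]
    · refine Finset.prod_congr rfl fun j hj => ?_
      simp [hg, Finset.ne_of_mem_erase hj]
  calc _ = ∫ ω, Set.indicator {ω : Fin m → E | ω i ∈ B ∧
        ∑ j ∈ Finset.univ.erase i, A.indicator (1 : E → ℝ) (ω j) ≤ n} 1 ω
          ∂Measure.pi fun _ => μ := (integral_indicator_one hS).symm
    _ ≤ ∫ ω : Fin m → E, Real.exp n * ∏ j, g j (ω j) ∂Measure.pi fun _ => μ := by
        refine integral_mono ((integrable_const (1 : ℝ)).indicator hS) hint fun ω => ?_
        rw [Set.indicator_apply]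
        split_ifs with hω
        · have h1 : B.indicator (1 : E → ℝ) (ω i) = 1 := Set.indicator_of_mem hω.1 _
          rw [hprod, h1, Pi.one_apply, one_mul, ← Real.exp_add]
          exact Real.one_le_exp (by linarith [hω.2])
        · exact mul_nonneg (Real.exp_nonneg _) (Finset.prod_nonneg fun j _ => hg0 _ _)
    _ = Real.exp n * ∏ j, ∫ y, g j y ∂μ := by
        rw [integral_const_mul, integral_fintype_prod_eq_prod]
    _ ≤ Real.exp n * (μ.real B * Real.exp (-(μ.real A / 2)) ^ (m - 1)) := by
        rw [← Finset.mul_prod_erase _ _ (Finset.mem_univ i)]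
        gcongr
        · exact Finset.prod_nonneg fun j _ => integral_nonneg (hg0 j)
        · simp only [hg, if_true]
          rw [integral_indicator_one hB]
        · have hcard : (Finset.univ.erase i).card = m - 1 := by
            rw [Finset.card_erase_of_mem (Finset.mem_univ i), Finset.card_univ, Fintype.card_fin]
          rw [← hcard, ← Finset.prod_const]
          refine Finset.prod_le_prod (fun j _ => integral_nonneg (hg0 j)) fun j hj => ?_
          simp only [hg, Finset.ne_of_mem_erase hj, if_false]
          exact integral_exp_neg_indicator μ hA
    _ = _ := by
        have hm : 1 ≤ m := Nat.one_le_iff_ne_zero.2 fun h => by subst h; exact i.elim0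
        rw [← Real.exp_nat_mul, Nat.cast_sub hm, Nat.cast_one, mul_left_comm, ← Real.exp_add]
        congr 2
        ring

/-- The probability that the Benjamini–Hochberg procedure makes a type II error on a given test:
with thresholds `c ≤ d, e`, where `d` is the threshold corresponding to `n + 1` rejections and `e`
the Bonferroni threshold. -/
theorem bhRule_typeTwo_le (γ : Params) {m : ℕ} {α : ℝ} (hα : 0 ≤ α) (i : Fin m) (n : ℕ)
    {c d e : ℝ} (hcd : c ≤ d) (hce : c ≤ e)
    (hd : normalTail d ≤ (n + 1) * α / m) (he : normalTail e ≤ α / m) :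
    (γ.dataLaw m).real {ω | (ω i).1 = true ∧ i ∉ bhRule γ m α fun j => (ω j).2} ≤
      γ.p * (γ.typeTwo d + (γ.typeTwo e - γ.typeTwo c) *
        Real.exp (n - (m - 1) * (γ.p * (1 - γ.typeTwo d) / 2))) := by
  classical
  have hp := γ.p_pos
  have hp1 := γ.p_lt_one
  have hm : 1 ≤ m := Nat.one_le_iff_ne_zero.2 fun h => by subst h; exact i.elim0
  have hm' : (1 : ℝ) ≤ m := by exact_mod_cast hm
  set D : Set ℝ := {x | d ≤ |x| / γ.σ} with hDdef
  have hD : MeasurableSet D := γ.measurableSet_le_abs d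
  set B : Set ℝ := {x | c ≤ |x| / γ.σ} \ {x | e ≤ |x| / γ.σ} with hBdef
  have hB : MeasurableSet B := (γ.measurableSet_le_abs c).diff (γ.measurableSet_le_abs e)
  set t : ℝ := (n + 1) * α / m with ht
  set A : Set ℝ := {x | pValue γ x ≤ t} with hAdef
  have hA : MeasurableSet A := measurableSet_le (measurable_pValue γ) measurable_const
  have hDA : D ⊆ A := fun x hx => by
    rw [hAdef, Set.mem_ofPred_eq, pValue_eq]
    exact (normalTail_antitone hx).trans hd
  have hms : MeasurableSet {y : Bool × ℝ | y.1 = true} :=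
    measurable_fst (measurableSet_singleton true)
  have hA' : MeasurableSet {y : Bool × ℝ | y.2 ∈ A} := measurable_snd hA
  have hB' : MeasurableSet {y : Bool × ℝ | y.1 = true ∧ y.2 ∈ B} := hms.inter (measurable_snd hB)
  -- An alternative is missed either below `d`, or above `d` but below the Bonferroni threshold `e`
  -- with at most `n` other small p-values. As `d` and `e` are not ordered, the second event is
  -- enlarged to the range from `c` to `e`.
  have hsub : {ω : Fin m → Bool × ℝ | (ω i).1 = true ∧ i ∉ bhRule γ m α fun j => (ω j).2} ⊆
      {ω | ω i ∈ {y : Bool × ℝ | y.1 = true ∧ y.2 ∈ Dᶜ}} ∪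
      {ω | ω i ∈ {y : Bool × ℝ | y.1 = true ∧ y.2 ∈ B} ∧
        ∑ j ∈ Finset.univ.erase i,
          {y : Bool × ℝ | y.2 ∈ A}.indicator (1 : Bool × ℝ → ℝ) (ω j) ≤ n} := by
    rintro ω ⟨h1, h2⟩
    by_cases hx : (ω i).2 ∈ D
    · refine Or.inr ⟨⟨h1, hcd.trans hx, fun hxe => ?_⟩, ?_⟩
      · refine h2 ((mem_bhRule_iff γ hα _ i).2 ⟨1, le_rfl, ?_, ?_⟩)
        · refine Finset.one_le_card.2 ⟨i, ?_⟩
          simp only [Finset.mem_filter, Finset.mem_univ, true_and, pValue_eq]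
          rw [Nat.cast_one, one_mul]
          exact (normalTail_antitone hxe).trans he
        · rw [pValue_eq, Nat.cast_one, one_mul]
          exact (normalTail_antitone hxe).trans he
      · by_contra hcon
        rw [not_le] at hcon
        have hsum : ∑ j ∈ Finset.univ.erase i,
            {y : Bool × ℝ | y.2 ∈ A}.indicator (1 : Bool × ℝ → ℝ) (ω j) =
            (((Finset.univ.erase i).filter fun j => (ω j).2 ∈ A).card : ℝ) := by
          rw [Finset.card_filter]
          push_cast
          refine Finset.sum_congr rfl fun j _ => ?_
          simp [Set.indicator_apply]
        rw [hsum] at hcon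
        have hcon' : n < ((Finset.univ.erase i).filter fun j => (ω j).2 ∈ A).card := by
          exact_mod_cast hcon
        refine h2 ((mem_bhRule_iff γ hα _ i).2 ⟨n + 1, by omega, ?_, ?_⟩)
        · refine hcon'.trans_le (Finset.card_le_card fun j hj => ?_)
          simp only [Finset.mem_filter, Finset.mem_univ, true_and] at hj ⊢
          push_cast
          exact hj.2
        · push_cast
          exact hDA hx
    · exact Or.inl ⟨h1, hx⟩
  have hmsD : MeasurableSet {y : Bool × ℝ | y.1 = true ∧ y.2 ∈ Dᶜ} :=
    hms.inter (measurable_snd hD.compl)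
  refine (measureReal_mono hsub).trans ((measureReal_union_le _ _).trans ?_)
  rw [γ.dataLaw_real_coord i hmsD, γ.pairLaw_real_true hD.compl, measureReal_compl hD,
    γ.altLaw_real_le_abs, probReal_univ, mul_add]
  refine add_le_add le_rfl ?_
  refine (pi_real_card_lt_le γ.pairLaw i hA' hB' n).trans ?_
  rw [γ.pairLaw_real_true hB, mul_assoc]
  have hBr : γ.altLaw.real B = γ.typeTwo e - γ.typeTwo c := by
    have hsub' : {x | e ≤ |x| / γ.σ} ⊆ {x | c ≤ |x| / γ.σ} := fun x hx => hce.trans hx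
    rw [hBdef, measureReal_sdiff hsub'
      (γ.measurableSet_le_abs e), γ.altLaw_real_le_abs, γ.altLaw_real_le_abs, Params.typeTwo,
      Params.typeTwo]
    ring
  have hAr : γ.p * (1 - γ.typeTwo d) ≤ γ.pairLaw.real {y : Bool × ℝ | y.2 ∈ A} := by
    rw [γ.pairLaw_real_snd hA]
    have h1 : 0 ≤ (1 - γ.p) * γ.nullLaw.real A :=
      mul_nonneg (by linarith) measureReal_nonneg
    have h2 : 1 - γ.typeTwo d ≤ γ.altLaw.real A := by
      rw [Params.typeTwo, sub_sub_cancel, ← γ.altLaw_real_le_abs]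
      exact measureReal_mono hDA
    have := mul_le_mul_of_nonneg_left h2 hp.le
    linarith
  rw [hBr]
  have hec : 0 ≤ γ.typeTwo e - γ.typeTwo c := sub_nonneg.2 (γ.typeTwo_mono hce)
  have : 0 ≤ (m : ℝ) - 1 := by linarith
  gcongr

/-! ### Comparison with the rule controlling the BFDR -/

namespace Params

variable (γ : Params)

theorem typeTwo_pos {c : ℝ} (hc : 0 < c) : 0 < γ.typeTwo c := by
  have hu := γ.u_pos
  have hx : 0 < c / √(1 + γ.u) := by positivity
  have h := le_one_sub_normalTail hx.le le_rfl
  have := gaussianPDFReal_zero_one_pos (c / √(1 + γ.u))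
  exact lt_of_lt_of_le (by positivity) h

/-- The Bayes risk per false null hypothesis of the threshold rule with threshold `c ^ 2`, in units
of the loss of a type II error. -/
def normRisk (c : ℝ) : ℝ := γ.f * γ.δ * normalTail c + γ.typeTwo c

theorem normRisk_nonneg (c : ℝ) : 0 ≤ γ.normRisk c :=
  add_nonneg (mul_nonneg (mul_pos γ.f_pos γ.δ_pos).le (normalTail_nonneg c)) (γ.typeTwo_nonneg c)

theorem typeTwo_le_normRisk (c : ℝ) : γ.typeTwo c ≤ γ.normRisk c :=
  le_add_of_nonneg_left (mul_nonneg (mul_pos γ.f_pos γ.δ_pos).le (normalTail_nonneg c))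

theorem fδ_mul_sqrt_u : γ.f * γ.δ * √γ.u = √γ.v := by
  have hf := γ.f_pos
  have hδ := γ.δ_pos
  have hu := γ.u_pos
  rw [show γ.v = γ.u * (γ.f * γ.δ) ^ 2 by unfold v; ring, Real.sqrt_mul hu.le,
    Real.sqrt_sq (by positivity), mul_comm]

end Params

/-- A bounded multiple of the tail is reached after a shift by `O(1 / c)`. -/
theorem normalTail_shift_le {c l : ℝ} (hc : 0 < c) (hl : 0 ≤ l) :
    normalTail (c + l / c) ≤ Real.exp (-l) * normalTail c := by
  have := normalTail_add_le_exp_mul hc.le (div_nonneg hl hc.le)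
  rwa [mul_div_cancel₀ _ hc.ne'] at this

theorem typeTwo_shift_le (γ : Params) {c l : ℝ} (hc : 0 < c) (hl : 0 ≤ l) :
    γ.typeTwo (c + l / c) ≤ (1 + l / c ^ 2) * γ.typeTwo c := by
  have h : c + l / c = (1 + l / c ^ 2) * c := by field_simp
  rw [h]
  exact γ.typeTwo_mul_le (by have : 0 ≤ l / c ^ 2 := by positivity
                             linarith) hc.le

/-- This equation, the BFDR condition cleared of denominators, is the only link between `α` and `c`:
it makes `G(c)` and `α p` comparable. -/
theorem bfdr_relation (γ : Params) {c α : ℝ} (hc : 0 ≤ c) (h : bfdr γ (c ^ 2) = α) :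
    (1 - α) * ((1 - γ.p) * normalTail c) = α * (γ.p * (1 - γ.typeTwo c)) := by
  have hp1 : 0 < 1 - γ.p := by linarith [γ.p_lt_one]
  have hG := normalTail_pos c
  have hT : 0 ≤ γ.p * (1 - γ.typeTwo c) :=
    mul_nonneg γ.p_pos.le (by linarith [γ.typeTwo_le_one c])
  have hpos : 0 < (1 - γ.p) * normalTail c := by positivity
  rw [bfdr_sq γ hc, div_eq_iff (by linarith)] at h
  linarith

theorem bfdr_pos (γ : Params) {c : ℝ} (hc : 0 ≤ c) : 0 < bfdr γ (c ^ 2) := by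
  have hp1 : 0 < 1 - γ.p := by linarith [γ.p_lt_one]
  have hG := normalTail_pos c
  have hT : 0 ≤ γ.p * (1 - γ.typeTwo c) :=
    mul_nonneg γ.p_pos.le (by linarith [γ.typeTwo_le_one c])
  rw [bfdr_sq γ hc]
  positivity

theorem bhRule_typeOne_sum_le (γ : Params) {m : ℕ} {c α a κ s : ℝ} (hs : 0 < s)
    (hα : 0 < α) (hαa : α ≤ a) (ha : a < 1) (hκ : 0 < κ) (hsm : s ≤ m * γ.p) (hc : 0 ≤ c)
    (hbfdr : bfdr γ (c ^ 2) = α) (hT : κ ≤ 1 - γ.typeTwo c) :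
    ∑ i : Fin m, γ.δ0 *
      (γ.dataLaw m).real {ω | (ω i).1 = false ∧ i ∈ bhRule γ m α fun j => (ω j).2} ≤
      m * γ.p * γ.δA * ((2 / s + 1) / (1 - a) ^ 2 / κ * (γ.f * γ.δ * normalTail c)) := by
  have hp := γ.p_pos
  have hp1 : 0 < 1 - γ.p := by linarith [γ.p_lt_one]
  have hδ0 := γ.δ0_pos
  have hδA := γ.δA_pos
  have hα1 : 0 < 1 - α := by linarith
  have ha1 : 0 < 1 - a := by linarith
  have hmp : 0 < m * γ.p := hs.trans_le hsm
  have hm : (0 : ℝ) < m := pos_of_mul_pos_left hmp hp.le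
  have hG := normalTail_pos c
  have hmean : (1 + m * γ.p) / (1 - α) + α / (1 - α) ^ 2 ≤
      (2 / s + 1) / (1 - a) ^ 2 * (m * γ.p) := by
    have h1 : 1 ≤ m * γ.p / s := (one_le_div hs).2 hsm
    have h3 : (1 - a) ^ 2 ≤ (1 - α) ^ 2 := by gcongr
    have h4 : (1 + m * γ.p) / (1 - α) ≤ (1 + m * γ.p) / (1 - a) ^ 2 := by
      gcongr
      nlinarith
    have h5 : α / (1 - α) ^ 2 ≤ 1 / (1 - a) ^ 2 := by
      gcongr
      linarith
    calc _ ≤ (1 + m * γ.p) / (1 - a) ^ 2 + 1 / (1 - a) ^ 2 := add_le_add h4 h5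
      _ = (2 * 1 + m * γ.p) / (1 - a) ^ 2 := by ring
      _ ≤ (2 * (m * γ.p / s) + m * γ.p) / (1 - a) ^ 2 := by gcongr
      _ = _ := by ring
  have hα_le : α * γ.p ≤ (1 - γ.p) * normalTail c / κ := by
    rw [le_div_iff₀ hκ]
    have h := bfdr_relation γ hc hbfdr
    have h1 : α * γ.p * κ ≤ α * γ.p * (1 - γ.typeTwo c) := by gcongr
    have h2 : (1 - α) * ((1 - γ.p) * normalTail c) ≤ 1 * ((1 - γ.p) * normalTail c) := by
      gcongr
      linarith
    linarith
  set K := (2 / s + 1) / (1 - a) ^ 2 with hK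
  have hK0 : 0 < K := by positivity
  calc _ ≤ ∑ _i : Fin m, γ.δ0 *
        ((1 - γ.p) * (((1 + m * γ.p) / (1 - α) + α / (1 - α) ^ 2) * α / m)) := by
        gcongr with i _
        exact bhRule_typeOne_le γ hα.le (by linarith) i
    _ = γ.δ0 * (1 - γ.p) * α * ((1 + m * γ.p) / (1 - α) + α / (1 - α) ^ 2) := by
        rw [Finset.sum_const, Finset.card_univ, Fintype.card_fin, nsmul_eq_mul]
        field_simp
    _ ≤ γ.δ0 * 1 * α * (K * (m * γ.p)) := by
        gcongr
        linarith
    _ = γ.δ0 * K * m * (α * γ.p) := by ring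
    _ ≤ γ.δ0 * K * m * ((1 - γ.p) * normalTail c / κ) := by gcongr
    _ = _ := by
        rw [Params.f, Params.δ]
        field_simp

theorem bhRule_typeTwo_prob_le (γ : Params) {m : ℕ} {c α a κ : ℝ} (hm : 2 ≤ m)
    (hα : 0 < α) (hαa : α ≤ a) (ha : a < 1) (hκ : 0 < κ) (hκ1 : κ ≤ 1) (hp2 : γ.p ≤ 1 / 2)
    (hc : 0 < c) (hcK : 2 / κ * Real.log (32 / ((1 - a) * κ)) ≤ c ^ 2)
    (hbfdr : bfdr γ (c ^ 2) = α) (hT : κ ≤ 1 - γ.typeTwo c) (i : Fin m) :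
    (γ.dataLaw m).real {ω | (ω i).1 = true ∧ i ∉ bhRule γ m α fun j => (ω j).2} ≤
      γ.p * ((1 + (Real.log (32 / ((1 - a) * κ)) + 32 / ((1 - a) * κ)) / c ^ 2) *
        γ.typeTwo c) := by
  have hp := γ.p_pos
  have hp1 : 0 < 1 - γ.p := by linarith
  have ha0 : 0 < a := by linarith
  have ha1 : 0 < 1 - a := by linarith
  have hα1 : 0 < 1 - α := by linarith
  have hm' : (2 : ℝ) ≤ m := by exact_mod_cast hm
  have hm0 : (0 : ℝ) < m := by linarith
  have hT0 := γ.typeTwo_nonneg c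
  set G := normalTail c with hG
  have hG0 : 0 < G := normalTail_pos c
  -- Chosen so that `W κ / 16 = 2 / (1 - a)`, the constant in `G(c) ≤ 2 / (1 - a) · α p`. Lowering
  -- the tail by the factor `W` then reaches the level of about `κ m p / 16` rejections.
  set W := 32 / ((1 - a) * κ) with hW
  have hW1 : 1 ≤ W := by
    rw [hW, one_le_div (by positivity)]
    nlinarith
  have hW0 : 0 < W := by linarith
  set l := Real.log W with hl
  have hl0 : 0 ≤ l := Real.log_nonneg hW1
  set x := m * γ.p with hx
  have hx0 : 0 < x := by positivity
  -- The shift `l' / c` lowers the tail from `G(c)` to the Bonferroni level `α / m`.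
  set l' := Real.log (1 + W * (κ / 16) * x) with hl'
  have hl'0 : 0 ≤ l' := Real.log_nonneg (by
    have : 0 ≤ W * (κ / 16) * x := by positivity
    linarith)
  have hGle : G ≤ W * (κ / 16) * (α * γ.p) := by
    have h := bfdr_relation γ hc.le hbfdr
    have h1 : (1 - a) * (1 / 2 * G) ≤ (1 - α) * ((1 - γ.p) * G) := by
      gcongr
      linarith
    have h2 : α * (γ.p * (1 - γ.typeTwo c)) ≤ α * (γ.p * 1) := by
      gcongr
      linarith
    have hWk : W * (κ / 16) = 2 / (1 - a) := by
      rw [hW]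
      field_simp
      norm_num
    rw [hWk, div_mul_eq_mul_div, le_div_iff₀ ha1]
    linarith
  set n := ⌊κ / 16 * x⌋₊ with hn
  have hn1 : κ / 16 * x ≤ n + 1 := (Nat.lt_floor_add_one _).le
  have hn2 : (n : ℝ) ≤ κ / 16 * x := Nat.floor_le (by positivity)
  have hd : normalTail (c + l / c) ≤ (n + 1) * α / m := by
    refine (normalTail_shift_le hc hl0).trans ?_
    rw [Real.exp_neg, Real.exp_log hW0, inv_mul_le_iff₀ hW0, ← hG]
    refine hGle.trans ?_
    rw [mul_assoc]
    refine mul_le_mul_of_nonneg_left ?_ hW0.le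
    rw [le_div_iff₀ hm0]
    calc κ / 16 * (α * γ.p) * m = κ / 16 * x * α := by rw [hx]; ring
      _ ≤ _ := by gcongr
  have he : normalTail (c + l' / c) ≤ α / m := by
    refine (normalTail_shift_le hc hl'0).trans ?_
    have hpos : 0 < 1 + W * (κ / 16) * x := by positivity
    rw [Real.exp_neg, Real.exp_log hpos, inv_mul_le_iff₀ hpos, ← hG]
    refine hGle.trans ?_
    calc W * (κ / 16) * (α * γ.p) = W * (κ / 16) * x * (α / m) := by rw [hx]; field_simp
      _ ≤ _ := by
        gcongr
        linarith
  have hcd : c ≤ c + l / c := le_add_of_nonneg_right (by positivity)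
  have hce : c ≤ c + l' / c := le_add_of_nonneg_right (by positivity)
  refine (bhRule_typeTwo_le γ hα.le i n hcd hce hd he).trans ?_
  have hTd := typeTwo_shift_le γ hc hl0
  have hTe := typeTwo_shift_le γ hc hl'0
  have hTd' : κ / 2 ≤ 1 - γ.typeTwo (c + l / c) := by
    have h1 : l / c ^ 2 ≤ κ / 2 := by
      rw [div_le_iff₀ (by positivity)]
      have := mul_le_mul_of_nonneg_left hcK (show 0 ≤ κ / 2 by positivity)
      rw [← mul_assoc, show κ / 2 * (2 / κ) = 1 by field_simp, one_mul] at this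
      exact this
    have h2 : l / c ^ 2 * γ.typeTwo c ≤ κ / 2 * 1 := by
      gcongr
      exact γ.typeTwo_le_one c
    linarith
  -- The Chernoff exponent is at least `κ m p / 8`, from `m - 1 ≥ m / 2` and `1 - T(d) ≥ κ / 2`;
  -- since `n` is at most half of this, `κ m p / 16` remains.
  have hexp : Real.exp (n - (m - 1) * (γ.p * (1 - γ.typeTwo (c + l / c)) / 2)) ≤
      Real.exp (-(κ / 16 * x)) := by
    refine Real.exp_le_exp.2 ?_
    have h1 : (m / 2 : ℝ) * (γ.p * (κ / 2) / 2) ≤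
        (m - 1) * (γ.p * (1 - γ.typeTwo (c + l / c)) / 2) := by
      gcongr
      · linarith
      · linarith
    have h2 : (m / 2 : ℝ) * (γ.p * (κ / 2) / 2) = 2 * (κ / 16 * x) := by rw [hx]; ring
    linarith
  -- The shift towards Bonferroni grows like `log(m p)`, but it is paid only on an event of
  -- exponentially small probability, so the product is bounded uniformly in `m p`.
  have hle : l' * Real.exp (-(κ / 16 * x)) ≤ W := by
    have h1 : l' ≤ W * (κ / 16) * x := by
      have := Real.log_le_sub_one_of_pos (show 0 < 1 + W * (κ / 16) * x by positivity)
      linarith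
    have h2 : κ / 16 * x ≤ Real.exp (κ / 16 * x) := by
      have := Real.add_one_le_exp (κ / 16 * x)
      linarith
    rw [Real.exp_neg, ← div_eq_mul_inv, div_le_iff₀ (Real.exp_pos _)]
    calc l' ≤ W * (κ / 16 * x) := by linarith
      _ ≤ _ := by gcongr
  gcongr
  calc γ.typeTwo (c + l / c) + (γ.typeTwo (c + l' / c) - γ.typeTwo c) *
        Real.exp (n - (m - 1) * (γ.p * (1 - γ.typeTwo (c + l / c)) / 2))
      ≤ (1 + l / c ^ 2) * γ.typeTwo c + (l' / c ^ 2 * γ.typeTwo c) *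
          Real.exp (-(κ / 16 * x)) := by
        gcongr
        linarith
    _ = (1 + (l + l' * Real.exp (-(κ / 16 * x))) / c ^ 2) * γ.typeTwo c := by ring
    _ ≤ _ := by gcongr

/-- The Bayes risk of the Benjamini–Hochberg procedure in terms of the error probabilities of the
rule controlling the BFDR at the same level. -/
theorem exists_risk_bhRule_le {a κ s : ℝ} (ha : a < 1) (hκ : 0 < κ) (hκ1 : κ ≤ 1) (hs : 0 < s) :
    ∃ K : ℝ, 0 < K ∧ ∀ (γ : Params) (m : ℕ) (c α : ℝ), 2 ≤ m → 0 < α → α ≤ a → γ.p ≤ 1 / 2 →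
      s ≤ m * γ.p → 0 < c → K ≤ c ^ 2 → bfdr γ (c ^ 2) = α → κ ≤ 1 - γ.typeTwo c →
      risk γ (bhRule γ m α) ≤ m * γ.p * γ.δA *
        (K * (γ.f * γ.δ * normalTail c) + (1 + K / c ^ 2) * γ.typeTwo c) := by
  have ha1 : 0 < 1 - a := by linarith
  set K₁ := (2 / s + 1) / (1 - a) ^ 2 / κ
  set K₂ := 2 / κ * Real.log (32 / ((1 - a) * κ))
  set K₃ := Real.log (32 / ((1 - a) * κ)) + 32 / ((1 - a) * κ)
  have hK₁ : 0 < K₁ := by positivity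
  refine ⟨max K₁ (max K₂ K₃), lt_max_of_lt_left hK₁, ?_⟩
  intro γ m c α hm hα hαa hp hsm hc hcK hb hT
  have hδA := γ.δA_pos
  have hG := normalTail_nonneg c
  have hT0 := γ.typeTwo_nonneg c
  have hf := γ.f_pos
  have hδ := γ.δ_pos
  have hp0 := γ.p_pos
  have h1 := bhRule_typeOne_sum_le γ hs hα hαa ha hκ hsm hc.le hb hT
  have h2 := fun i => bhRule_typeTwo_prob_le γ hm hα hαa ha hκ hκ1 hp hc
    (le_trans ((le_max_left _ _).trans (le_max_right _ _)) hcK) hb hT i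
  rw [risk_eq, Finset.sum_add_distrib]
  calc _ ≤ m * γ.p * γ.δA * (K₁ * (γ.f * γ.δ * normalTail c)) +
        ∑ _i : Fin m, γ.δA * (γ.p * ((1 + K₃ / c ^ 2) * γ.typeTwo c)) := by
        gcongr with i _
        exact h2 i
    _ = m * γ.p * γ.δA *
        (K₁ * (γ.f * γ.δ * normalTail c) + (1 + K₃ / c ^ 2) * γ.typeTwo c) := by
        rw [Finset.sum_const, Finset.card_univ, Fintype.card_fin, nsmul_eq_mul]
        ring
    _ ≤ _ := by
        gcongr
        · exact le_max_left _ _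
        · exact (le_max_right _ _).trans (le_max_right _ _)

/-! ### Thresholds of asymptotically optimal rules -/

theorem measurableSet_thresholdRule (γ : Params) (m : ℕ) (K : ℝ) (i : Fin m) :
    MeasurableSet {x : Fin m → ℝ | i ∈ thresholdRule γ m K x} :=
  measurable_pi_apply (X := fun _ : Fin m => ℝ) i (measurableSet_rejectSet γ K)

/-- At the threshold `log v`, the type I component of the risk is negligible. -/
theorem typeOne_sqrt_log_v_le (γ : Params) {M : ℝ} (hu : 1 ≤ γ.u) (hv : 1 < γ.v)
    (hM : √(Real.log γ.v) / √(1 + γ.u) ≤ M) :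
    γ.f * γ.δ * normalTail √(Real.log γ.v) * (gaussianPDFReal 0 1 M * √(Real.log γ.v)) ≤
      γ.typeTwo √(Real.log γ.v) := by
  have hL : 0 < Real.log γ.v := Real.log_pos hv
  set ℓ := √(Real.log γ.v) with hℓ
  have hℓ0 : 0 < ℓ := Real.sqrt_pos.2 hL
  have hu0 : 0 < γ.u := by linarith
  have hf := γ.f_pos
  have hδ := γ.δ_pos
  have hsu : 0 < √γ.u := Real.sqrt_pos.2 hu0
  have hφ := gaussianPDFReal_zero_one_pos M
  have h1 : γ.f * γ.δ * normalTail ℓ ≤ 1 / √γ.u := by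
    -- The threshold `ℓ ^ 2 = log v` is tuned for `exp (-ℓ ^ 2 / 2) = 1 / √v`, where `√v = f δ √u`.
    -- The type I component is thus at most `1 / √u`, while the type II error is of order at least
    -- `ℓ / √u`.
    have h2 : normalTail ℓ ≤ (√γ.v)⁻¹ := by
      refine (normalTail_le_exp hℓ0.le).trans_eq ?_
      rw [hℓ, Real.sq_sqrt hL.le, Real.sqrt_eq_rpow, Real.rpow_def_of_pos γ.v_pos, ← Real.exp_neg]
      congr 1
      ring
    have hsv : 0 < √γ.v := Real.sqrt_pos.2 γ.v_pos
    rw [le_div_iff₀ hsu, mul_right_comm, γ.fδ_mul_sqrt_u]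
    calc √γ.v * normalTail ℓ ≤ √γ.v * (√γ.v)⁻¹ := by gcongr
      _ = 1 := mul_inv_cancel₀ hsv.ne'
  have h3 : √(1 + γ.u) ≤ 2 * √γ.u := by
    rw [Real.sqrt_le_left (by positivity), mul_pow, Real.sq_sqrt hu0.le]
    linarith
  have h4 := le_one_sub_normalTail (x := ℓ / √(1 + γ.u)) (by positivity) hM
  calc _ ≤ 1 / √γ.u * (gaussianPDFReal 0 1 M * ℓ) := by gcongr
    _ = 2 * gaussianPDFReal 0 1 M * (ℓ / (2 * √γ.u)) := by field_simp
    _ ≤ 2 * gaussianPDFReal 0 1 M * (ℓ / √(1 + γ.u)) := by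
      have : 0 < √(1 + γ.u) := by positivity
      gcongr
    _ ≤ _ := h4

/-- The exponents differ by a quantity quadratic in `x`, because `(1 - η) x + 1` falls short of `x`
by a fixed proportion; an exponent of `2 x` already suffices. -/
theorem eventually_le_gaussianPDFReal_mul_exp {η : ℝ} (hη : 0 < η) (hη1 : η < 1) :
    ∀ᶠ x : ℝ in atTop,
      3 * x ≤ 2 * gaussianPDFReal 0 1 ((1 - η) * x + 1) * Real.exp (x ^ 2 / 2) := by
  filter_upwards [eventually_ge_atTop (8 / η)] with x hx
  have hx8 : 8 ≤ η * x := by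
    rw [div_le_iff₀ hη] at hx
    linarith
  have hx0 : 0 < x := pos_of_mul_pos_right (by linarith) hη.le
  have hx8' : 8 ≤ x := hx8.trans (by nlinarith)
  have hexp : 2 * x ≤ x ^ 2 / 2 - ((1 - η) * x + 1) ^ 2 / 2 := by
    have h1 : 8 * x ≤ η * x * x := by gcongr
    have h2 : 0 ≤ η * x * ((1 - η) * x) := by
      have : 0 ≤ 1 - η := by linarith
      positivity
    nlinarith
  have hsqrt : √(2 * Real.pi) ≤ 4 := by
    rw [Real.sqrt_le_left (by norm_num)]
    linarith [Real.pi_le_four]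
  have hpos : 0 < √(2 * Real.pi) := by positivity
  rw [gaussianPDFReal_zero_one, mul_assoc, mul_assoc, ← Real.exp_add]
  have h5 : Real.exp (2 * x) ≤
      Real.exp (-((1 - η) * x + 1) ^ 2 / 2 + x ^ 2 / 2) := by
    refine Real.exp_le_exp.2 (hexp.trans_eq ?_)
    ring
  have h7 : (1 / 4 : ℝ) ≤ (√(2 * Real.pi))⁻¹ := by
    rw [one_div]
    exact inv_anti₀ hpos hsqrt
  have h8 : 6 * x ≤ (√(2 * Real.pi))⁻¹ * Real.exp (2 * x) * 2 := by
    have h9 : 12 * x ≤ Real.exp (2 * x) := by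
      have := Real.quadratic_le_exp_of_nonneg (show 0 ≤ 2 * x by positivity)
      nlinarith
    have := mul_le_mul h7 h9 (by positivity) (by positivity)
    linarith
  have h10 : (√(2 * Real.pi))⁻¹ * Real.exp (2 * x) ≤ (√(2 * Real.pi))⁻¹ *
      Real.exp (-((1 - η) * x + 1) ^ 2 / 2 + x ^ 2 / 2) := by gcongr
  linarith

/-- A threshold which is too small compared with `log v` has a large type I component of the
risk. -/
theorem three_mul_typeTwo_le_typeOne (γ : Params) {η c : ℝ} (hη1 : η < 1)
    (hv : 1 < γ.v) (hc : c ≤ (1 - η) * √(Real.log γ.v))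
    (h : 3 * √(Real.log γ.v) ≤ 2 * gaussianPDFReal 0 1 ((1 - η) * √(Real.log γ.v) + 1) *
      Real.exp (√(Real.log γ.v) ^ 2 / 2)) :
    3 * γ.typeTwo √(Real.log γ.v) ≤ γ.f * γ.δ * normalTail c := by
  have hL : 0 < Real.log γ.v := Real.log_pos hv
  set ℓ := √(Real.log γ.v) with hℓ
  have hℓ0 : 0 < ℓ := Real.sqrt_pos.2 hL
  have hu0 := γ.u_pos
  have hf := γ.f_pos
  have hδ := γ.δ_pos
  have hsu : 0 < √γ.u := Real.sqrt_pos.2 hu0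
  have hη0 : 0 < 1 - η := by linarith
  have h1 : γ.typeTwo ℓ ≤ ℓ / √γ.u := by
    refine (one_sub_normalTail_le (by positivity)).trans ?_
    gcongr
    linarith
  have h2 : Real.exp (ℓ ^ 2 / 2) = γ.f * γ.δ * √γ.u := by
    rw [γ.fδ_mul_sqrt_u, hℓ, Real.sq_sqrt hL.le, Real.sqrt_eq_rpow,
      Real.rpow_def_of_pos γ.v_pos]
    congr 1
    ring
  calc 3 * γ.typeTwo ℓ ≤ 3 * (ℓ / √γ.u) := by gcongr
    _ = 3 * ℓ / √γ.u := by ring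
    _ ≤ 2 * gaussianPDFReal 0 1 ((1 - η) * ℓ + 1) * Real.exp (ℓ ^ 2 / 2) / √γ.u := by gcongr
    _ = γ.f * γ.δ * (2 * gaussianPDFReal 0 1 ((1 - η) * ℓ + 1)) := by
      rw [h2]
      field_simp
    _ ≤ γ.f * γ.δ * normalTail ((1 - η) * ℓ) := by
      gcongr
      exact le_normalTail (by positivity)
    _ ≤ _ := by
      gcongr
      exact normalTail_antitone hc

theorem exists_sqrt_log_v_div_le {γ : ℕ → Params} (hA : AssumptionA γ) :
    ∃ M : ℝ, ∀ᶠ m in atTop, √(Real.log (γ m).v) / √(1 + (γ m).u) ≤ M := by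
  obtain ⟨-, -, C, hC0, hC⟩ := hA
  refine ⟨√(C + 1), ?_⟩
  filter_upwards [hC.eventually_lt_const (lt_add_one C)] with m hm
  have hu := (γ m).u_pos
  rw [← Real.sqrt_div' _ (by positivity)]
  refine Real.sqrt_le_sqrt ?_
  rcases le_total (Real.log (γ m).v) 0 with h | h
  · refine (div_nonpos_of_nonpos_of_nonneg h (by positivity)).trans ?_
    linarith
  · refine le_trans ?_ hm.le
    gcongr
    linarith

/-- An asymptotically optimal threshold rule: with `ℓ ^ 2 = log v`, its risk is at most
`(1 + ε)` times the type II component of the risk at `ℓ`. -/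
theorem eventually_normRisk_le {γ : ℕ → Params} (hA : AssumptionA γ) {c : ℕ → ℝ}
    (hc : ∀ᶠ m in atTop, 0 ≤ c m)
    (hopt : AsymptoticallyOptimal γ fun m => thresholdRule (γ m) m (c m ^ 2))
    {ε : ℝ} (hε : 0 < ε) :
    ∀ᶠ m in atTop, (γ m).normRisk (c m) ≤ (1 + ε) * (γ m).typeTwo √(Real.log (γ m).v) := by
  obtain ⟨M, hM⟩ := exists_sqrt_log_v_div_le hA
  obtain ⟨hu, hv, -⟩ := hA
  set ε' := min (ε / 3) 1
  have hε' : 0 < ε' := lt_min (by positivity) one_pos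
  have hεε : (1 + ε') * (1 + ε') ≤ 1 + ε := by
    have h1 : ε' ≤ ε / 3 := min_le_left _ _
    have h2 : ε' ≤ 1 := min_le_right _ _
    nlinarith
  have hφ := gaussianPDFReal_zero_one_pos M
  have hℓ : Tendsto (fun m => √(Real.log (γ m).v)) atTop atTop :=
    Real.tendsto_sqrt_atTop.comp (Real.tendsto_log_atTop.comp hv)
  filter_upwards [hc, hM, hu.eventually_ge_atTop 1, hv.eventually_gt_atTop 1,
    hℓ.eventually_ge_atTop (1 / (gaussianPDFReal 0 1 M * ε')), eventually_ge_atTop 1,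
    Filter.Tendsto.eventually_le_const (show (1 : ℝ) < 1 + ε' by linarith) hopt,
    Filter.Tendsto.eventually_const_lt (show (0 : ℝ) < 1 by norm_num) hopt]
    with m hc hM hu hv hℓ hm hle hpos
  have hp := (γ m).p_pos
  have hδA := (γ m).δA_pos
  have hf := (γ m).f_pos
  have hδ := (γ m).δ_pos
  have hm0 : (0 : ℝ) < m := by exact_mod_cast hm
  have hopt0 : 0 < optRisk (γ m) m := by
    have h0 : 0 ≤ optRisk (γ m) m := risk_nonneg _ _
    refine lt_of_le_of_ne h0 fun h => ?_
    -- A vanishing optimal risk would make the ratio `0` by convention, against its convergence to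
    -- `1`.
    rw [← h, div_zero] at hpos
    exact lt_irrefl _ hpos
  set ℓ := √(Real.log (γ m).v) with hℓdef
  have h1 := optRisk_le_risk (γ m) (thresholdRule (γ m) m (ℓ ^ 2))
    (measurableSet_thresholdRule _ _ _)
  rw [div_le_iff₀ hopt0, risk_thresholdRule_sq _ _ hc] at hle
  rw [risk_thresholdRule_sq _ _ (Real.sqrt_nonneg _)] at h1
  have h2 : (γ m).f * (γ m).δ * normalTail ℓ ≤ ε' * (γ m).typeTwo ℓ := by
    have h3 := typeOne_sqrt_log_v_le (γ m) hu hv hM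
    rw [div_le_iff₀ (by positivity)] at hℓ
    have hG := normalTail_nonneg ℓ
    calc (γ m).f * (γ m).δ * normalTail ℓ
        = (γ m).f * (γ m).δ * normalTail ℓ * 1 := (mul_one _).symm
      _ ≤ (γ m).f * (γ m).δ * normalTail ℓ * (ℓ * (gaussianPDFReal 0 1 M * ε')) := by gcongr
      _ = ε' * ((γ m).f * (γ m).δ * normalTail ℓ * (gaussianPDFReal 0 1 M * ℓ)) := by ring
      _ ≤ _ := by gcongr
  have h4 : (γ m).normRisk (c m) ≤ (1 + ε') * (γ m).normRisk ℓ := by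
    have hpos' : 0 < m * (γ m).p * (γ m).δA := by positivity
    refine le_of_mul_le_mul_left ?_ hpos'
    refine (show _ ≤ _ from hle).trans ?_
    rw [mul_left_comm]
    gcongr
    exact h1
  have hT := (γ m).typeTwo_nonneg ℓ
  calc (γ m).normRisk (c m) ≤ (1 + ε') * (γ m).normRisk ℓ := h4
    _ ≤ (1 + ε') * (ε' * (γ m).typeTwo ℓ + (γ m).typeTwo ℓ) := by
      unfold Params.normRisk
      gcongr
    _ = (1 + ε') * (1 + ε') * (γ m).typeTwo ℓ := by ring
    _ ≤ _ := by gcongr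

/-- The thresholds of asymptotically optimal threshold rules are at least of the order of that of
the Bayes oracle. -/
theorem eventually_le_threshold {γ : ℕ → Params} (hA : AssumptionA γ) {c : ℕ → ℝ}
    (hc : ∀ᶠ m in atTop, 0 ≤ c m)
    (hopt : AsymptoticallyOptimal γ fun m => thresholdRule (γ m) m (c m ^ 2))
    {η : ℝ} (hη : 0 < η) (hη1 : η < 1) :
    ∀ᶠ m in atTop, (1 - η) * √(Real.log (γ m).v) ≤ c m := by
  have h1 := eventually_normRisk_le hA hc hopt one_pos
  obtain ⟨hu, hv, -⟩ := hA
  have hℓ : Tendsto (fun m => √(Real.log (γ m).v)) atTop atTop :=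
    Real.tendsto_sqrt_atTop.comp (Real.tendsto_log_atTop.comp hv)
  filter_upwards [h1, hv.eventually_gt_atTop 1,
    hℓ.eventually (eventually_le_gaussianPDFReal_mul_exp hη hη1)] with m h1 hv h2
  by_contra hcon
  -- A smaller threshold would cost at least `3 T(ℓ)` in type I errors alone, whereas
  -- near-optimality with `ε = 1` allows only `2 T(ℓ)` in total.
  have h3 := three_mul_typeTwo_le_typeOne (γ m) hη1 hv (not_le.1 hcon).le h2
  have h4 := (γ m).typeTwo_pos (Real.sqrt_pos.2 (Real.log_pos hv))
  have h5 := (γ m).typeTwo_nonneg (c m)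
  unfold Params.normRisk at h1
  linarith

/-- The type I component of the risk of asymptotically optimal threshold rules is negligible. -/
theorem tendsto_typeOne_div_normRisk {γ : ℕ → Params} (hA : AssumptionA γ) {c : ℕ → ℝ}
    (hc : ∀ᶠ m in atTop, 0 ≤ c m)
    (hopt : AsymptoticallyOptimal γ fun m => thresholdRule (γ m) m (c m ^ 2)) :
    Tendsto (fun m => (γ m).f * (γ m).δ * normalTail (c m) / (γ m).normRisk (c m)) atTop (𝓝 0) := by
  have hv := hA.2.1
  refine tendsto_order.2 ⟨fun b hb => Eventually.of_forall fun m => hb.trans_le ?_, fun b hb => ?_⟩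
  · exact div_nonneg (mul_nonneg (mul_pos (γ m).f_pos (γ m).δ_pos).le (normalTail_nonneg _))
      ((γ m).normRisk_nonneg _)
  -- The total is at most `(1 + η) T(ℓ)` and its type II part at least `(1 - η) T(ℓ)`, leaving at
  -- most `2 η T(ℓ)` for type I. The two bounds on `η` give `2 η ≤ b / 3 < 2 b / 3 ≤ b (1 - η)`.
  · set η := min (b / 6) (1 / 3)
    have hη : 0 < η := lt_min (by positivity) (by norm_num)
    have hη1 : η ≤ b / 6 := min_le_left _ _
    have hη2 : η ≤ 1 / 3 := min_le_right _ _
    filter_upwards [eventually_normRisk_le hA hc hopt hη,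
      eventually_le_threshold hA hc hopt hη (by linarith), hv.eventually_gt_atTop 1] with m h1 h2 hv
    set ℓ := √(Real.log (γ m).v)
    have hℓ0 : 0 < ℓ := Real.sqrt_pos.2 (Real.log_pos hv)
    have hT0 := (γ m).typeTwo_pos hℓ0
    have hη0 : 0 < 1 - η := by linarith
    have h3 : (1 - η) * (γ m).typeTwo ℓ ≤ (γ m).typeTwo (c m) := by
      have h4 := (γ m).typeTwo_mul_le (r := (1 - η)⁻¹) (c := (1 - η) * ℓ)
        ((one_le_inv₀ hη0).2 (by linarith)) (by positivity)
      rw [inv_mul_cancel_left₀ hη0.ne'] at h4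
      refine le_trans ?_ ((γ m).typeTwo_mono h2)
      rwa [← le_inv_mul_iff₀ hη0]
    have h5 : (1 - η) * (γ m).typeTwo ℓ ≤ (γ m).normRisk (c m) :=
      h3.trans ((γ m).typeTwo_le_normRisk _)
    have h6 : 0 < (γ m).normRisk (c m) := lt_of_lt_of_le (by positivity) h5
    rw [div_lt_iff₀ h6]
    have h7 : (γ m).f * (γ m).δ * normalTail (c m) ≤ 2 * η * (γ m).typeTwo ℓ := by
      unfold Params.normRisk at h1
      linarith
    have h8 : 2 * η * (γ m).typeTwo ℓ < b * ((1 - η) * (γ m).typeTwo ℓ) := by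
      rw [← mul_assoc]
      refine mul_lt_mul_of_pos_right ?_ hT0
      have : b * (2 / 3) ≤ b * (1 - η) := by
        gcongr
        linarith
      linarith
    have h9 : b * ((1 - η) * (γ m).typeTwo ℓ) ≤ b * (γ m).normRisk (c m) := by gcongr
    linarith

/-- As `log v / u` is bounded, the power at `ℓ` is at least some `g > 0`. Near-optimality gives
`T(c) ≤ (1 + g / 2) (1 - g) ≤ 1 - g / 2`, so power is retained at `c`. -/
theorem exists_le_one_sub_typeTwo {γ : ℕ → Params} (hA : AssumptionA γ) {c : ℕ → ℝ}
    (hc : ∀ᶠ m in atTop, 0 ≤ c m)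
    (hopt : AsymptoticallyOptimal γ fun m => thresholdRule (γ m) m (c m ^ 2)) :
    ∃ κ : ℝ, 0 < κ ∧ κ ≤ 1 ∧ ∀ᶠ m in atTop, κ ≤ 1 - (γ m).typeTwo (c m) := by
  obtain ⟨M, hM⟩ := exists_sqrt_log_v_div_le hA
  have hG := normalTail_pos M
  have hG1 := normalTail_le_one M
  refine ⟨normalTail M / 2, by positivity, by linarith, ?_⟩
  filter_upwards [hM, eventually_normRisk_le hA hc hopt (show 0 < normalTail M / 2 by positivity)]
    with m hM h
  have h1 : (γ m).typeTwo √(Real.log (γ m).v) ≤ 1 - normalTail M := by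
    have := normalTail_antitone hM
    unfold Params.typeTwo
    linarith
  have h2 := (γ m).typeTwo_le_normRisk (c m)
  have h3 : (1 + normalTail M / 2) * (γ m).typeTwo √(Real.log (γ m).v) ≤
      (1 + normalTail M / 2) * (1 - normalTail M) := by gcongr
  nlinarith

theorem tendsto_threshold_atTop {γ : ℕ → Params} (hA : AssumptionA γ) {c : ℕ → ℝ}
    (hc : ∀ᶠ m in atTop, 0 ≤ c m)
    (hopt : AsymptoticallyOptimal γ fun m => thresholdRule (γ m) m (c m ^ 2)) :
    Tendsto c atTop atTop := by
  have hℓ : Tendsto (fun m => √(Real.log (γ m).v)) atTop atTop :=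
    Real.tendsto_sqrt_atTop.comp (Real.tendsto_log_atTop.comp hA.2.1)
  refine tendsto_atTop_mono' _ (eventually_le_threshold hA hc hopt (η := 1 / 2) (by norm_num)
    (by norm_num)) (hℓ.const_mul_atTop (by norm_num))

end SparseTesting

end

theorem theorem6p1
    (γ : ℕ → SparseTesting.Params) (hA : SparseTesting.AssumptionA γ)
    (hp : Tendsto (fun m => (γ m).p) atTop (𝓝 0))
    (s : EReal) (hs : 0 < s)
    (hmp : Tendsto (fun m : ℕ => (((m : ℝ) * (γ m).p : ℝ) : EReal)) atTop (𝓝 s))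
    (α : ℕ → ℝ) (αInf : ℝ) (hαInf : αInf < 1) (hα : Tendsto α atTop (𝓝 αInf))
    (cB : ℕ → ℝ)
    (hcB : ∀ᶠ m in atTop, 0 ≤ cB m ∧ SparseTesting.bfdr (γ m) (cB m ^ 2) = α m)
    (hcB_opt : SparseTesting.AsymptoticallyOptimal γ
      (fun m => SparseTesting.thresholdRule (γ m) m (cB m ^ 2)))
    (hu : (∃ Cp : ℝ, 0 < Cp ∧ Cp ≤ 1 ∧
        Tendsto (fun m : ℕ => Real.log ((m : ℝ) * (γ m).p) / Real.log (m : ℝ)) atTop (𝓝 Cp)) →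
      ∃ β : ℝ, 0 < β ∧ ∀ᶠ m : ℕ in atTop, (γ m).u ≤ (m : ℝ) ^ β) :
    SparseTesting.AsymptoticallyOptimal γ
      (fun m => SparseTesting.bhRule (γ m) m (α m)) := by
  open SparseTesting in
  have hc0 : ∀ᶠ m in atTop, 0 ≤ cB m := hcB.mono fun m h => h.1
  obtain ⟨κ, hκ, hκ1, hκm⟩ := exists_le_one_sub_typeTwo hA hc0 hcB_opt
  have hratio := tendsto_typeOne_div_normRisk hA hc0 hcB_opt
  have hctop := tendsto_threshold_atTop hA hc0 hcB_opt
  -- A real number strictly below `s` bounds `m p` from below eventually, which treats finite and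
  -- infinite `s` together.
  obtain ⟨r, hr0, hrs⟩ := EReal.lt_iff_exists_real_btwn.1 hs
  have hr : 0 < r := by exact_mod_cast hr0
  obtain ⟨K, hK, hrisk⟩ := exists_risk_bhRule_le (a := (αInf + 1) / 2) (by linarith) hκ hκ1 hr
  have hc2 : Tendsto (fun m => cB m ^ 2) atTop atTop :=
    (tendsto_pow_atTop two_ne_zero).comp hctop
  have hbound : ∀ᶠ m in atTop,
      optRisk (γ m) m ≤ risk (γ m) (bhRule (γ m) m (α m)) ∧ 0 < optRisk (γ m) m ∧
      risk (γ m) (bhRule (γ m) m (α m)) ≤ risk (γ m) (thresholdRule (γ m) m (cB m ^ 2)) *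
        (K * ((γ m).f * (γ m).δ * normalTail (cB m) / (γ m).normRisk (cB m)) +
          (1 + K / cB m ^ 2)) := by
    filter_upwards [hcB, hκm, hctop.eventually_gt_atTop 0, hc2.eventually_ge_atTop K,
      hp.eventually_le_const (show (0 : ℝ) < 1 / 2 by norm_num),
      hmp.eventually_const_lt hrs, hα.eventually_le_const (show αInf < (αInf + 1) / 2 by linarith),
      eventually_ge_atTop 2,
      Filter.Tendsto.eventually_const_lt (show (0 : ℝ) < 1 by norm_num) hcB_opt]
      with m hcB hκm hc hcK hp hrm hαa hm hpos
    -- Positivity of the level is automatic, since every BFDR is positive.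
    have hα0 : 0 < α m := hcB.2 ▸ bfdr_pos (γ m) hcB.1
    refine ⟨optRisk_le_risk _ _ (measurableSet_bhRule _ _ hα0.le), ?_, ?_⟩
    · refine lt_of_le_of_ne (risk_nonneg _ _) fun h => ?_
      rw [← h, div_zero] at hpos
      exact lt_irrefl _ hpos
    · have hrm' : r < m * (γ m).p := by exact_mod_cast hrm
      refine (hrisk (γ m) m (cB m) (α m) hm hα0 hαa hp hrm'.le hc hcK hcB.2 hκm).trans ?_
      have hδA := (γ m).δA_pos
      have hp0 := (γ m).p_pos
      have hn0 : 0 < (γ m).normRisk (cB m) :=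
        ((γ m).typeTwo_pos hc).trans_le ((γ m).typeTwo_le_normRisk _)
      rw [risk_thresholdRule_sq _ _ hcB.1, mul_assoc (_ * _ * _)]
      change _ ≤ _ * ((γ m).normRisk (cB m) * _)
      rw [mul_add ((γ m).normRisk (cB m)), mul_left_comm _ K, mul_div_cancel₀ _ hn0.ne',
        mul_comm ((γ m).normRisk (cB m))]
      gcongr
      exact (γ m).typeTwo_le_normRisk _
  -- The constant `K` multiplies the vanishing share of the type I component, and `K / c ^ 2`
  -- vanishes because `c → ∞`, so the correction factor tends to `1`.
  have hlim : Tendsto (fun m => risk (γ m) (thresholdRule (γ m) m (cB m ^ 2)) / optRisk (γ m) m *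
        (K * ((γ m).f * (γ m).δ * normalTail (cB m) / (γ m).normRisk (cB m)) +
          (1 + K / cB m ^ 2))) atTop (𝓝 1) := by
    have h := Filter.Tendsto.mul hcB_opt
      ((hratio.const_mul K).add ((hc2.const_div_atTop K).const_add 1))
    simpa using h
  refine tendsto_of_tendsto_of_tendsto_of_le_of_le' tendsto_const_nhds hlim ?_ ?_
  · filter_upwards [hbound] with m h
    exact (one_le_div h.2.1).2 h.1
  · filter_upwards [hbound] with m h
    rw [div_mul_eq_mul_div]
    exact div_le_div_of_nonneg_right h.2.2 h.2.1.le
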